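/- Let $\mathbf 3$ be the discrete (equality) order with underlying set $\{0,1,2\}$. Over the base theory $\mathsf{RCA}_0$ of second order arithmetic, the statement that $\mathbf 3$ is $\mathsf{BQO}$ (a better quasi order) implies arithmetical comprehension. In other words: if $\mathcal M$ is a model of $\mathsf{RCA}_0$ (with a possibly nonstandard first order part and an arbitrary collection of sets) in which $\mathbf 3$ is $\mathsf{BQO}$, then for every arithmetical formula $\varphi(n)$ with number and set parameters from $\mathcal M$, the set $\{n\mid\varphi(n)\}$ exists in $\mathcal M$. Here $\mathsf{RCA}_0$ consists of the basic axioms on $0,1,+,\cdot,<$, induction for $\Sigma^0_1$-formulas and comprehension for $\Delta^0_1$-properties. The following definitions are made in $\mathsf{RCA}_0$, with finite sets of numbers given by their codes. For finite sets $s,t\subseteq\mathbb N$, write $s\vartriangleleft t$ if there is a finite set $u$ such that $s$ is an initial segment of $u$ and $t$ is an initial segment of $u$ without its least element. A barrier is a set $B$ of finite subsets of $\mathbb N$ such that the base $\bigcup B$ is infinite, each infinite set $X\subseteq\bigcup B$ has an initial segment in $B$, and no element of $B$ is a proper subset of another one. A quasi order $Q$ is $\mathsf{BQO}$ if for each barrier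 $B$ and each function (array) $f:B\to Q$ there are $s,t\in B$ with $s\vartriangleleft t$ and $f(s)\leq_Q f(t)$. -/

import Mathlib

universe u

namespace SecondOrderArithmetic

/-! ## The language of second order arithmetic -/

/-- Numerical terms of the language of second order arithmetic, with number variables
`0, …, k - 1`. -/
inductive Term (k : ℕ) : Type
  | var : Fin k → Term k
  | zero : Term k
  | one : Term k
  | add : Term k → Term k → Term k
  | mul : Term k → Term k → Term k

/-- Renaming of variables for passing under a number quantifier: the result does not contain
the variable `0`, which is the one that the quantifier binds. -/
def Term.lift {k : ℕ} : Term k → Term (k + 1)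
  | .var i => .var i.succ
  | .zero => .zero
  | .one => .one
  | .add s t => .add s.lift t.lift
  | .mul s t => .mul s.lift t.lift

/-- Formulas of the language of second order arithmetic, with free number variables
`0, …, k - 1` and free set variables `0, …, m - 1`. A quantifier binds the variable `0` (of its
sort) of its body; the other variables are shifted by one. -/
inductive Formula : ℕ → ℕ → Type
  | eq {k m : ℕ} : Term k → Term k → Formula k m
  | lt {k m : ℕ} : Term k → Term k → Formula k m
  | mem {k m : ℕ} : Term k → Fin m → Formula k m
  | neg {k m : ℕ} : Formula k m → Formula k m
  | and {k m : ℕ} : Formula k m → Formula k m → Formula k m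
  | or {k m : ℕ} : Formula k m → Formula k m → Formula k m
  | imp {k m : ℕ} : Formula k m → Formula k m → Formula k m
  | allNum {k m : ℕ} : Formula (k + 1) m → Formula k m
  | exNum {k m : ℕ} : Formula (k + 1) m → Formula k m
  | allSet {k m : ℕ} : Formula k (m + 1) → Formula k m
  | exSet {k m : ℕ} : Formula k (m + 1) → Formula k m

/-- Bounded (`Σ⁰₀`) formulas: all quantifiers are of the form `∀ x < t` or `∃ x < t`, with a
term `t` in which `x` does not occur. -/
inductive Formula.IsBounded : {k m : ℕ} → Formula k m → Prop
  | eq {k m : ℕ} (s t : Term k) : IsBounded (Formula.eq s t : Formula k m)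
  | lt {k m : ℕ} (s t : Term k) : IsBounded (Formula.lt s t : Formula k m)
  | mem {k m : ℕ} (t : Term k) (X : Fin m) : IsBounded (Formula.mem t X)
  | neg {k m : ℕ} {φ : Formula k m} : IsBounded φ → IsBounded (.neg φ)
  | and {k m : ℕ} {φ ψ : Formula k m} : IsBounded φ → IsBounded ψ → IsBounded (.and φ ψ)
  | or {k m : ℕ} {φ ψ : Formula k m} : IsBounded φ → IsBounded ψ → IsBounded (.or φ ψ)
  | imp {k m : ℕ} {φ ψ : Formula k m} : IsBounded φ → IsBounded ψ → IsBounded (.imp φ ψ)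
  | ball {k m : ℕ} (t : Term k) {φ : Formula (k + 1) m} :
      IsBounded φ → IsBounded (.allNum (.imp (.lt (.var 0) t.lift) φ))
  | bex {k m : ℕ} (t : Term k) {φ : Formula (k + 1) m} :
      IsBounded φ → IsBounded (.exNum (.and (.lt (.var 0) t.lift) φ))

/-- `Σ⁰₁` formulas: `∃ x, θ` with `θ` bounded. -/
def Formula.IsSigma01 {k m : ℕ} (φ : Formula k m) : Prop :=
  ∃ θ : Formula (k + 1) m, θ.IsBounded ∧ φ = .exNum θ

/-- `Π⁰₁` formulas: `∀ x, θ` with `θ` bounded. -/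
def Formula.IsPi01 {k m : ℕ} (φ : Formula k m) : Prop :=
  ∃ θ : Formula (k + 1) m, θ.IsBounded ∧ φ = .allNum θ

/-- Arithmetical formulas: no set quantifiers (free set variables are allowed). -/
def Formula.IsArithmetical : {k m : ℕ} → Formula k m → Prop
  | _, _, .eq _ _ => True
  | _, _, .lt _ _ => True
  | _, _, .mem _ _ => True
  | _, _, .neg φ => φ.IsArithmetical
  | _, _, .and φ ψ => φ.IsArithmetical ∧ ψ.IsArithmetical
  | _, _, .or φ ψ => φ.IsArithmetical ∧ ψ.IsArithmetical
  | _, _, .imp φ ψ => φ.IsArithmetical ∧ ψ.IsArithmetical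
  | _, _, .allNum φ => φ.IsArithmetical
  | _, _, .exNum φ => φ.IsArithmetical
  | _, _, .allSet _ => False
  | _, _, .exSet _ => False

end SecondOrderArithmetic

/-! ## Structures and satisfaction -/

/-- A structure for the language of second order arithmetic. The number quantifiers range over
`Num`, which may be nonstandard, and the set quantifiers range over the collection `sets` of
subsets of `Num`. -/
structure L2Structure : Type (u + 1) where
  Num : Type u
  zero : Num
  one : Num
  add : Num → Num → Num
  mul : Num → Num → Num
  lt : Num → Num → Prop
  sets : Set (Set Num)

namespace L2Structure

open SecondOrderArithmetic

variable (M : L2Structure.{u})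

instance : Zero M.Num := ⟨M.zero⟩
instance : One M.Num := ⟨M.one⟩
instance : Add M.Num := ⟨M.add⟩
instance : Mul M.Num := ⟨M.mul⟩
instance : LT M.Num := ⟨M.lt⟩

/-- The value of a term under an assignment of numbers to its variables. -/
def termVal {k : ℕ} (e : Fin k → M.Num) : Term k → M.Num
  | .var i => e i
  | .zero => 0
  | .one => 1
  | .add s t => termVal e s + termVal e t
  | .mul s t => termVal e s * termVal e t

/-- Satisfaction of a formula under assignments of numbers and sets of the structure to its free
variables. -/
def Realize : {k m : ℕ} → Formula k m → (Fin k → M.Num) → (Fin m → M.sets) → Prop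
  | _, _, .eq s t, e, _ => M.termVal e s = M.termVal e t
  | _, _, .lt s t, e, _ => M.termVal e s < M.termVal e t
  | _, _, .mem t X, e, v => M.termVal e t ∈ (v X : Set M.Num)
  | _, _, .neg φ, e, v => ¬ Realize φ e v
  | _, _, .and φ ψ, e, v => Realize φ e v ∧ Realize ψ e v
  | _, _, .or φ ψ, e, v => Realize φ e v ∨ Realize ψ e v
  | _, _, .imp φ ψ, e, v => Realize φ e v → Realize ψ e v
  | _, _, .allNum φ, e, v => ∀ a : M.Num, Realize φ (Fin.cons a e) v
  | _, _, .exNum φ, e, v => ∃ a : M.Num, Realize φ (Fin.cons a e) v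
  | _, _, .allSet φ, e, v => ∀ X : M.sets, Realize φ e (Fin.cons X v)
  | _, _, .exSet φ, e, v => ∃ X : M.sets, Realize φ e (Fin.cons X v)

/-! ## The axioms -/

/-- The basic axioms on `0, 1, +, ·, <`. -/
structure BasicAxioms : Prop where
  succ_ne_zero : ∀ a : M.Num, a + 1 ≠ 0
  succ_inj : ∀ a b : M.Num, a + 1 = b + 1 → a = b
  add_zero : ∀ a : M.Num, a + 0 = a
  add_succ : ∀ a b : M.Num, a + (b + 1) = (a + b) + 1
  mul_zero : ∀ a : M.Num, a * 0 = 0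
  mul_succ : ∀ a b : M.Num, a * (b + 1) = a * b + a
  not_lt_zero : ∀ a : M.Num, ¬ a < 0
  lt_succ_iff : ∀ a b : M.Num, a < b + 1 ↔ a < b ∨ a = b

/-- Induction for `Σ⁰₁` formulas, with number and set parameters. -/
def Sigma01Induction : Prop :=
  ∀ (k m : ℕ) (φ : Formula (k + 1) m), φ.IsSigma01 →
    ∀ (e : Fin k → M.Num) (v : Fin m → M.sets),
      M.Realize φ (Fin.cons 0 e) v →
      (∀ a : M.Num, M.Realize φ (Fin.cons a e) v → M.Realize φ (Fin.cons (a + 1) e) v) →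
      ∀ a : M.Num, M.Realize φ (Fin.cons a e) v

/-- Comprehension for `Δ⁰₁` properties, with number and set parameters. -/
def Delta01Comprehension : Prop :=
  ∀ (k m : ℕ) (φ ψ : Formula (k + 1) m), φ.IsSigma01 → ψ.IsPi01 →
    ∀ (e : Fin k → M.Num) (v : Fin m → M.sets),
      (∀ a : M.Num, M.Realize φ (Fin.cons a e) v ↔ M.Realize ψ (Fin.cons a e) v) →
      ∃ X ∈ M.sets, ∀ a : M.Num, a ∈ X ↔ M.Realize φ (Fin.cons a e) v

/-- `M` is a model of `RCA₀`. -/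
structure IsModelRCA0 : Prop where
  basic : M.BasicAxioms
  sigma01_induction : M.Sigma01Induction
  delta01_comprehension : M.Delta01Comprehension

/-- `M` satisfies arithmetical comprehension: every instance of the scheme
`∃ X, ∀ n, (n ∈ X ↔ φ(n))` for arithmetical `φ`, with number and set parameters. -/
def ArithmeticalComprehension : Prop :=
  ∀ (k m : ℕ) (φ : Formula (k + 1) m), φ.IsArithmetical →
    ∀ (e : Fin k → M.Num) (v : Fin m → M.sets),
      ∃ X ∈ M.sets, ∀ a : M.Num, a ∈ X ↔ M.Realize φ (Fin.cons a e) v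

/-! ## Finite sets inside a structure

In the following definitions all quantifiers range over the numbers and sets of `M`, so that each
of them expresses satisfaction in `M` of a formula of second order arithmetic. -/

variable {M}

/-- The usual pairing function of second order arithmetic. -/
def pair (a b : M.Num) : M.Num := (a + b) * (a + b) + a

/-- `i` lies in the finite set given by the number `c = (k, (m, n))`, which consists of all
`i < k` such that `m (i + 1) + 1` divides `n`. -/
def InCode (i c : M.Num) : Prop :=
  ∃ k m n : M.Num, c = pair k (pair m n) ∧ i < k ∧ ∃ q : M.Num, q * (m * (i + 1) + 1) = n

/-- `c` is the code of a finite set, i.e. the least number that gives this set: the elements of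
`[ℕ]^{<ω}` inside `M` are identified with their codes. -/
def IsFinCode (c : M.Num) : Prop :=
  ∀ d : M.Num, d < c → ¬ ∀ i : M.Num, InCode i d ↔ InCode i c

/-- The finite set with code `c`. -/
def elts (c : M.Num) : Set M.Num := {i | InCode i c}

/-- `S` is a (not necessarily proper) initial segment of `T`, for sets of numbers. -/
def IsInitSeg (S T : Set M.Num) : Prop :=
  S ⊆ T ∧ ∀ i ∈ S, ∀ j ∈ T, j < i → j ∈ S

/-- The set `S⁻`: the set `S` without its least element. -/
def tail (S : Set M.Num) : Set M.Num := {i | i ∈ S ∧ ∃ j ∈ S, j < i}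

/-- `s ◁ t`: there is a finite set `u` such that `s` is an initial segment of `u` and `t` is an
initial segment of `u⁻`. -/
def Shift (s t : M.Num) : Prop :=
  ∃ u : M.Num, IsFinCode u ∧ IsInitSeg (elts s) (elts u) ∧ IsInitSeg (elts t) (tail (elts u))

/-- `S` is infinite in the sense of `M`. -/
def IsUnbounded (S : Set M.Num) : Prop := ∀ a : M.Num, ∃ b ∈ S, a < b

/-! ## Barriers and better quasi orders -/

/-- The base of a set `B` of (codes of) finite sets: the union of these finite sets. -/
def base (B : Set M.Num) : Set M.Num := {i | ∃ s ∈ B, i ∈ elts s}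

/-- `B` is a barrier of `M`: a set of finite sets with infinite base, such that each infinite
subset of the base has an initial segment in `B` and no element of `B` is a proper subset of
another one. -/
structure IsBarrier (B : Set M.Num) : Prop where
  mem_sets : B ∈ M.sets
  isFinCode : ∀ s ∈ B, IsFinCode s
  base_infinite : IsUnbounded (base B)
  exists_initSeg : ∀ X ∈ M.sets, IsUnbounded X → X ⊆ base B → ∃ s ∈ B, IsInitSeg (elts s) X
  not_ssubset : ∀ s ∈ B, ∀ t ∈ B, ¬ elts s ⊂ elts t

/-- The set `f` of pairs is the graph of a function from `B` to `Q` in `M`. When `B` is a barrier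
this says that `f` is an array. -/
structure IsFunction (f B Q : Set M.Num) : Prop where
  mem_sets : f ∈ M.sets
  subset_prod : ∀ p ∈ f, ∃ s ∈ B, ∃ q ∈ Q, p = pair s q
  existsUnique : ∀ s ∈ B, ∃! q : M.Num, q ∈ Q ∧ pair s q ∈ f

/-- In `M`, the relation `le` is a quasi order on `Q`, and this quasi order is `BQO`: for each
array `f : B → Q` on a barrier `B` there are `s ◁ t` in `B` with `f(s) ≤ f(t)`. -/
structure IsBQO (Q : Set M.Num) (le : M.Num → M.Num → Prop) : Prop where
  refl : ∀ p ∈ Q, le p p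
  trans : ∀ p ∈ Q, ∀ q ∈ Q, ∀ r ∈ Q, le p q → le q r → le p r
  good : ∀ B : Set M.Num, IsBarrier B → ∀ f : Set M.Num, IsFunction f B Q →
    ∃ s ∈ B, ∃ t ∈ B, Shift s t ∧
      ∃ p q : M.Num, pair s p ∈ f ∧ pair t q ∈ f ∧ le p q

variable (M)

/-- The set `{0, 1, 2}` of `M`. -/
def three : Set M.Num := {a | a = 0 ∨ a = 1 ∨ a = 1 + 1}

/-- `M` satisfies the statement that the discrete order `𝟑` with underlying set `{0, 1, 2}`
is `BQO`. -/
def ThreeIsBQO : Prop := IsBQO M.three (fun a b => a = b)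

end L2Structure

set_option linter.unusedSectionVars false

/-! ### Renaming of variables -/

namespace SecondOrderArithmetic

/-! It suffices to show that the range of every injection `h` of the model exists. Every `Σ⁰₁` set
can be read off from such a range (`mem_range_enumInj`), and once all `Σ⁰₁` sets exist, the
quantifiers of an arithmetical formula can be absorbed one by one into set parameters
(`bd_realize_of_forall`).

Colour a triple `e < f < g` as ascending if the minimum of `h` on `[e, f)` is smaller than the one
on `[f, g)`. An infinite set without ascending triples would give an infinite descent
(`exists_asc`). On an infinite set with only ascending triples the minima tend to infinity, so that
the range of `h` becomes decidable (`range_mem_sets`). Hence if the range does not exist, every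
infinite set `X` has triples of both colours, and there is a least `z` such that `X ∩ [0, z]` is not
homogeneous. Passing to a subset can only increase `z`. The barrier consists of the finite sets of
size `z + 1`: a proper subset in the barrier would be smaller but have no smaller `z`.

For `s` in the barrier with this `z`, let `r` be the largest element of `s` such that `s ∩ [r, z]`
is still not homogeneous. The array has value `1` if the number of elements of `s` below `r` is odd.
Otherwise it has value `0` or `2`, according to the colour of the triples of `s` below `z`.

Let `s ◁ t`, and let `x₀` be the least element of `s`. If `t ∩ [0, z]` is not homogeneous, then `s`
and `t` share `z` and `r`, and dropping `x₀` flips the parity. If it is homogeneous, then `r = x₀`,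
so the parity of `s` is even. In this case the colours of `s` and `t` must differ: if they agreed,
the properties of minima would force `s ∩ [0, z]` to be homogeneous as well (`homogeneous_extend`).
So the array is bad (`par_up_of_shift`), contrary to the assumption on `𝟑`.

Most of the remaining work is a calculus of bounded, `Σ⁰₁` and `Δ⁰₁` relations, by which instance
search replaces the writing of formulas, together with arithmetic and finite set codes inside the
model. -/

def Term.rename {n n' : ℕ} (ρ : Fin n → Fin n') : Term n → Term n'
  | .var i => .var (ρ i)
  | .zero => .zero
  | .one => .one
  | .add s t => .add (s.rename ρ) (t.rename ρ)
  | .mul s t => .mul (s.rename ρ) (t.rename ρ)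

/-- The extension of a renaming of variables to one additional variable, which is fixed. -/
def liftMap {n n' : ℕ} (ρ : Fin n → Fin n') : Fin (n + 1) → Fin (n' + 1) :=
  Fin.cons 0 (fun i => (ρ i).succ)

def Formula.rename : {n m n' m' : ℕ} → (Fin n → Fin n') → (Fin m → Fin m') →
    Formula n m → Formula n' m'
  | _, _, _, _, ρ, _, .eq s t => .eq (s.rename ρ) (t.rename ρ)
  | _, _, _, _, ρ, _, .lt s t => .lt (s.rename ρ) (t.rename ρ)
  | _, _, _, _, ρ, σ, .mem t X => .mem (t.rename ρ) (σ X)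
  | _, _, _, _, ρ, σ, .neg φ => .neg (φ.rename ρ σ)
  | _, _, _, _, ρ, σ, .and φ ψ => .and (φ.rename ρ σ) (ψ.rename ρ σ)
  | _, _, _, _, ρ, σ, .or φ ψ => .or (φ.rename ρ σ) (ψ.rename ρ σ)
  | _, _, _, _, ρ, σ, .imp φ ψ => .imp (φ.rename ρ σ) (ψ.rename ρ σ)
  | _, _, _, _, ρ, σ, .allNum φ => .allNum (φ.rename (liftMap ρ) σ)
  | _, _, _, _, ρ, σ, .exNum φ => .exNum (φ.rename (liftMap ρ) σ)
  | _, _, _, _, ρ, σ, .allSet φ => .allSet (φ.rename ρ (liftMap σ))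
  | _, _, _, _, ρ, σ, .exSet φ => .exSet (φ.rename ρ (liftMap σ))

/-- Keeps the bounds `t.lift` of bounded quantifiers in the required form under renaming. -/
theorem Term.rename_lift {n n' : ℕ} (ρ : Fin n → Fin n') (t : Term n) :
    t.lift.rename (liftMap ρ) = (t.rename ρ).lift := by
  induction t <;> simp_all [Term.lift, Term.rename, liftMap]

theorem Formula.IsBounded.rename {n m : ℕ} {φ : Formula n m} (h : φ.IsBounded) :
    ∀ {n' m' : ℕ} (ρ : Fin n → Fin n') (σ : Fin m → Fin m'), (φ.rename ρ σ).IsBounded := by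
  induction h with
  | eq s t => intros; exact .eq _ _
  | lt s t => intros; exact .lt _ _
  | mem t X => intros; exact .mem _ _
  | neg _ ih => intros; exact .neg (ih _ _)
  | and _ _ ih1 ih2 => intros; exact .and (ih1 _ _) (ih2 _ _)
  | or _ _ ih1 ih2 => intros; exact .or (ih1 _ _) (ih2 _ _)
  | imp _ _ ih1 ih2 => intros; exact .imp (ih1 _ _) (ih2 _ _)
  | ball t _ ih =>
    intro n' m' ρ σ
    simp only [Formula.rename, Term.rename, Term.rename_lift]
    exact .ball _ (ih _ _)
  | bex t _ ih =>
    intro n' m' ρ σ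
    simp only [Formula.rename, Term.rename, Term.rename_lift]
    exact .bex _ (ih _ _)

theorem Formula.IsSigma01.rename {n m : ℕ} {φ : Formula n m} (h : φ.IsSigma01)
    {n' m' : ℕ} (ρ : Fin n → Fin n') (σ : Fin m → Fin m') : (φ.rename ρ σ).IsSigma01 := by
  obtain ⟨θ, hθ, rfl⟩ := h
  exact ⟨_, hθ.rename _ _, rfl⟩

theorem Formula.IsPi01.rename {n m : ℕ} {φ : Formula n m} (h : φ.IsPi01)
    {n' m' : ℕ} (ρ : Fin n → Fin n') (σ : Fin m → Fin m') : (φ.rename ρ σ).IsPi01 := by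
  obtain ⟨θ, hθ, rfl⟩ := h
  exact ⟨_, hθ.rename _ _, rfl⟩

end SecondOrderArithmetic

/-! ### Relations and functions that are definable with parameters -/

namespace L2Structure

open SecondOrderArithmetic

theorem cons_comp_liftMap {α : Type*} {n n' : ℕ} (ρ : Fin n → Fin n') (a : α) (e : Fin n' → α) :
    (Fin.cons a e : Fin (n' + 1) → α) ∘ liftMap ρ = Fin.cons a (e ∘ ρ) := by
  funext i
  refine Fin.cases ?_ (fun j => ?_) i <;> simp [liftMap]

variable {M : L2Structure.{u}}

theorem termVal_rename {n n' : ℕ} (ρ : Fin n → Fin n') (e : Fin n' → M.Num) (t : Term n) :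
    M.termVal e (t.rename ρ) = M.termVal (e ∘ ρ) t := by
  induction t <;> simp_all [termVal, Term.rename]

theorem termVal_lift {n : ℕ} (a : M.Num) (e : Fin n → M.Num) (t : Term n) :
    M.termVal (Fin.cons a e) t.lift = M.termVal e t := by
  induction t <;> simp_all [termVal, Term.lift]

theorem realize_rename {n m : ℕ} (φ : Formula n m) :
    ∀ {n' m' : ℕ} (ρ : Fin n → Fin n') (σ : Fin m → Fin m') (e : Fin n' → M.Num)
      (v : Fin m' → M.sets),
      M.Realize (φ.rename ρ σ) e v ↔ M.Realize φ (e ∘ ρ) (v ∘ σ) := by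
  induction φ <;> intros <;>
    simp_all [Realize, Formula.rename, termVal_rename, cons_comp_liftMap]

/-- The value of a variable that stands for a coordinate of `x` or for a constant. -/
def look {k n : ℕ} (env : Fin n → Fin k ⊕ M.Num) (x : Fin k → M.Num) : Fin n → M.Num :=
  fun i => Sum.elim x id (env i)

/-- The relation `P` is defined by a formula from the class `C`, with parameters. -/
def Rep (C : ∀ n m : ℕ, Formula n m → Prop) {k : ℕ} (P : (Fin k → M.Num) → Prop) : Prop :=
  ∃ (n m : ℕ) (φ : Formula n m) (env : Fin n → Fin k ⊕ M.Num) (v : Fin m → M.sets),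
    C n m φ ∧ ∀ x, P x ↔ M.Realize φ (look env x) v

/-- Relations defined by bounded formulas with parameters. -/
class Bd {k : ℕ} (P : (Fin k → M.Num) → Prop) : Prop where
  out : Rep (fun _ _ φ => φ.IsBounded) P

/-- Relations defined by `Σ⁰₁` formulas with parameters. -/
class Sig {k : ℕ} (P : (Fin k → M.Num) → Prop) : Prop where
  out : Rep (fun _ _ φ => φ.IsSigma01) P

/-- Functions given by terms with parameters. -/
class Tm {k : ℕ} (f : (Fin k → M.Num) → M.Num) : Prop where
  out : ∃ (n : ℕ) (t : Term n) (env : Fin n → Fin k ⊕ M.Num), ∀ x, f x = M.termVal (look env x) t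

theorem look_append_castAdd {k n n' : ℕ} (env : Fin n → Fin k ⊕ M.Num)
    (env' : Fin n' → Fin k ⊕ M.Num) (x : Fin k → M.Num) :
    look (Fin.append env env') x ∘ Fin.castAdd n' = look env x := by
  funext i; simp [look]

theorem look_append_natAdd {k n n' : ℕ} (env : Fin n → Fin k ⊕ M.Num)
    (env' : Fin n' → Fin k ⊕ M.Num) (x : Fin k → M.Num) :
    look (Fin.append env env') x ∘ Fin.natAdd n = look env' x := by
  funext i; simp [look]

theorem append_comp_castAdd {α : Type*} {n n' : ℕ} (v : Fin n → α) (v' : Fin n' → α) :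
    Fin.append v v' ∘ Fin.castAdd n' = v := by
  funext i; simp

theorem append_comp_natAdd {α : Type*} {n n' : ℕ} (v : Fin n → α) (v' : Fin n' → α) :
    Fin.append v v' ∘ Fin.natAdd n = v' := by
  funext i; simp

/-- The variables of the two formulas are placed in disjoint blocks, so that both formulas share one
context and connectives can be applied. -/
theorem Rep.merge {C C' : ∀ n m : ℕ, Formula n m → Prop}
    (hC : ∀ {n m n' m' : ℕ} (ρ : Fin n → Fin n') (σ : Fin m → Fin m') (φ : Formula n m),
      C n m φ → C n' m' (φ.rename ρ σ))
    (hC' : ∀ {n m n' m' : ℕ} (ρ : Fin n → Fin n') (σ : Fin m → Fin m') (φ : Formula n m),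
      C' n m φ → C' n' m' (φ.rename ρ σ))
    {k : ℕ} {P Q : (Fin k → M.Num) → Prop} (hP : Rep C P) (hQ : Rep C' Q) :
    ∃ (n m : ℕ) (φ ψ : Formula n m) (env : Fin n → Fin k ⊕ M.Num) (v : Fin m → M.sets),
      C n m φ ∧ C' n m ψ ∧ (∀ x, P x ↔ M.Realize φ (look env x) v) ∧
        ∀ x, Q x ↔ M.Realize ψ (look env x) v := by
  obtain ⟨n, m, φ, env, v, hφ, h⟩ := hP
  obtain ⟨n', m', ψ, env', v', hψ, h'⟩ := hQ
  refine ⟨n + n', m + m', φ.rename (Fin.castAdd n') (Fin.castAdd m'),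
    ψ.rename (Fin.natAdd n) (Fin.natAdd m), Fin.append env env', Fin.append v v',
    hC _ _ _ hφ, hC' _ _ _ hψ, fun x => ?_, fun x => ?_⟩
  · rw [realize_rename, look_append_castAdd, append_comp_castAdd, h]
  · rw [realize_rename, look_append_natAdd, append_comp_natAdd, h']

theorem Rep.subst {C : ∀ n m : ℕ, Formula n m → Prop} {k l : ℕ} {P : (Fin k → M.Num) → Prop}
    (hP : Rep C P) (ρ : Fin k → Fin l ⊕ M.Num) : Rep C (fun x => P (look ρ x)) := by
  obtain ⟨n, m, φ, env, v, hφ, h⟩ := hP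
  refine ⟨n, m, φ, fun i => Sum.elim ρ .inr (env i), v, hφ, fun x => ?_⟩
  beta_reduce
  rw [h]
  have : look env (look ρ x) = look (fun i => Sum.elim ρ .inr (env i)) x := by
    funext i
    rcases h : env i <;> simp [look, h]
  rw [this]

theorem Rep.comp {C : ∀ n m : ℕ, Formula n m → Prop} {k l : ℕ} {P : (Fin k → M.Num) → Prop}
    (hP : Rep C P) (ρ : Fin k → Fin l) : Rep C (fun x => P (fun i => x (ρ i))) :=
  hP.subst (fun i => .inl (ρ i))

/-- A renaming of variables that makes the first coordinate the first variable. -/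
theorem exists_normal {k n : ℕ} (env : Fin n → Fin (k + 1) ⊕ M.Num) :
    ∃ (ρ : Fin n → Fin (n + 1)) (env' : Fin n → Fin k ⊕ M.Num), ∀ (a : M.Num) (x : Fin k → M.Num),
      (Fin.cons a (look env' x) : Fin (n + 1) → M.Num) ∘ ρ = look env (Fin.cons a x) := by
  refine ⟨fun i => Sum.elim (Fin.cons 0 (fun _ => i.succ)) (fun _ => i.succ) (env i),
    -- A slot that reads the first coordinate is redirected by `ρ` to variable `0`; the value `0`
    -- left in its place is a dummy.
    fun i => Sum.elim (Fin.cons (.inr 0) .inl) .inr (env i), fun a x => ?_⟩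
  funext i
  rcases h : env i with j | c
  · refine Fin.cases (fun h => ?_) (fun j h => ?_) j h <;> simp [look, h]
  · simp [look, h]

/-- A representation in which the first coordinate is the first variable. -/
theorem Rep.normal {C : ∀ n m : ℕ, Formula n m → Prop}
    (hC : ∀ {n m n' m' : ℕ} (ρ : Fin n → Fin n') (σ : Fin m → Fin m') (φ : Formula n m),
      C n m φ → C n' m' (φ.rename ρ σ))
    {k : ℕ} {P : M.Num → (Fin k → M.Num) → Prop}
    (hP : Rep C (fun x : Fin (k + 1) → M.Num => P (x 0) (fun i => x i.succ))) :
    ∃ (n m : ℕ) (φ : Formula (n + 1) m) (env : Fin n → Fin k ⊕ M.Num) (v : Fin m → M.sets),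
      C (n + 1) m φ ∧ ∀ a x, P a x ↔ M.Realize φ (Fin.cons a (look env x)) v := by
  obtain ⟨n, m, φ, env, v, hφ, h⟩ := hP
  obtain ⟨ρ, env', hρ⟩ := exists_normal env
  refine ⟨n, m, φ.rename ρ id, env', v, hC _ _ _ hφ, fun a x => ?_⟩
  rw [realize_rename, hρ]
  simpa using h (Fin.cons a x)

section Terms

variable {k : ℕ} {f g : (Fin k → M.Num) → M.Num}

theorem Tm.merge (hf : Tm f) (hg : Tm g) :
    ∃ (n : ℕ) (s t : Term n) (env : Fin n → Fin k ⊕ M.Num),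
      (∀ x, f x = M.termVal (look env x) s) ∧ ∀ x, g x = M.termVal (look env x) t := by
  obtain ⟨n, s, env, h⟩ := hf.out
  obtain ⟨n', t, env', h'⟩ := hg.out
  refine ⟨n + n', s.rename (Fin.castAdd n'), t.rename (Fin.natAdd n), Fin.append env env',
    fun x => ?_, fun x => ?_⟩
  · rw [termVal_rename, look_append_castAdd, h]
  · rw [termVal_rename, look_append_natAdd, h']

instance Tm.var (i : Fin k) : Tm (fun x : Fin k → M.Num => x i) :=
  ⟨1, .var 0, fun _ => .inl i, fun _ => rfl⟩

instance Tm.const (c : M.Num) : Tm (fun _ : Fin k → M.Num => c) :=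
  ⟨1, .var 0, fun _ => .inr c, fun _ => rfl⟩

instance Tm.add [hf : Tm f] [hg : Tm g] : Tm (fun x => f x + g x) := by
  obtain ⟨n, s, t, env, h, h'⟩ := hf.merge hg
  exact ⟨n, .add s t, env, fun x => by rw [h, h']; rfl⟩

instance Tm.mul [hf : Tm f] [hg : Tm g] : Tm (fun x => f x * g x) := by
  obtain ⟨n, s, t, env, h, h'⟩ := hf.merge hg
  exact ⟨n, .mul s t, env, fun x => by rw [h, h']; rfl⟩

instance Bd.eq [hf : Tm f] [hg : Tm g] : Bd (fun x => f x = g x) := by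
  obtain ⟨n, s, t, env, h, h'⟩ := hf.merge hg
  exact ⟨n, 0, .eq s t, env, Fin.elim0, .eq _ _, fun x => by beta_reduce; rw [h, h']; rfl⟩

instance Bd.lt [hf : Tm f] [hg : Tm g] : Bd (fun x => f x < g x) := by
  obtain ⟨n, s, t, env, h, h'⟩ := hf.merge hg
  exact ⟨n, 0, .lt s t, env, Fin.elim0, .lt _ _, fun x => by beta_reduce; rw [h, h']; rfl⟩

instance Bd.mem [hf : Tm f] (X : M.sets) : Bd (fun x => f x ∈ (X : Set M.Num)) := by
  obtain ⟨n, s, env, h⟩ := hf.out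
  exact ⟨n, 1, .mem s 0, env, fun _ => X, .mem _ _, fun x => by beta_reduce; rw [h]; rfl⟩

end Terms

section Bounded

variable {k : ℕ} {P Q : (Fin k → M.Num) → Prop}

theorem Bd.merge (hP : Bd P) (hQ : Bd Q) :
    ∃ (n m : ℕ) (φ ψ : Formula n m) (env : Fin n → Fin k ⊕ M.Num) (v : Fin m → M.sets),
      φ.IsBounded ∧ ψ.IsBounded ∧ (∀ x, P x ↔ M.Realize φ (look env x) v) ∧
        ∀ x, Q x ↔ M.Realize ψ (look env x) v :=
  Rep.merge (fun _ _ _ h => h.rename _ _) (fun _ _ _ h => h.rename _ _) hP.out hQ.out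

instance Bd.not [hP : Bd P] : Bd (fun x => ¬ P x) := by
  obtain ⟨n, m, φ, env, v, hφ, h⟩ := hP.out
  exact ⟨n, m, .neg φ, env, v, .neg hφ, fun x => by beta_reduce; rw [h]; rfl⟩

instance Bd.and [hP : Bd P] [hQ : Bd Q] : Bd (fun x => P x ∧ Q x) := by
  obtain ⟨n, m, φ, ψ, env, v, hφ, hψ, h, h'⟩ := hP.merge hQ
  exact ⟨n, m, .and φ ψ, env, v, .and hφ hψ, fun x => by beta_reduce; rw [h, h']; rfl⟩

instance Bd.or [hP : Bd P] [hQ : Bd Q] : Bd (fun x => P x ∨ Q x) := by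
  obtain ⟨n, m, φ, ψ, env, v, hφ, hψ, h, h'⟩ := hP.merge hQ
  exact ⟨n, m, .or φ ψ, env, v, .or hφ hψ, fun x => by beta_reduce; rw [h, h']; rfl⟩

instance Bd.imp [hP : Bd P] [hQ : Bd Q] : Bd (fun x => P x → Q x) := by
  obtain ⟨n, m, φ, ψ, env, v, hφ, hψ, h, h'⟩ := hP.merge hQ
  exact ⟨n, m, .imp φ ψ, env, v, .imp hφ hψ, fun x => by beta_reduce; rw [h, h']; rfl⟩

theorem Bd.comp {l : ℕ} (hP : Bd P) (ρ : Fin k → Fin l) : Bd (fun x => P (fun i => x (ρ i))) :=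
  ⟨hP.out.comp ρ⟩

theorem Bd.normal_bound {P : M.Num → (Fin k → M.Num) → Prop} {f : (Fin k → M.Num) → M.Num}
    (hf : Tm f) (hP : Bd (fun x : Fin (k + 1) → M.Num => P (x 0) (fun i => x i.succ))) :
    ∃ (n m : ℕ) (t : Term n) (φ : Formula (n + 1) m) (env : Fin n → Fin k ⊕ M.Num)
      (v : Fin m → M.sets), φ.IsBounded ∧ (∀ x, f x = M.termVal (look env x) t) ∧
        ∀ a x, P a x ↔ M.Realize φ (Fin.cons a (look env x)) v := by
  obtain ⟨n, m, φ, env, v, hφ, h⟩ := Rep.normal (fun _ _ _ h => h.rename _ _) hP.out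
  obtain ⟨n', t, env', h'⟩ := hf.out
  refine ⟨n + n', m, t.rename (Fin.natAdd n), φ.rename (liftMap (Fin.castAdd n')) id,
    Fin.append env env', v, hφ.rename _ _, fun x => ?_, fun a x => ?_⟩
  · rw [termVal_rename, look_append_natAdd, h']
  · rw [realize_rename, cons_comp_liftMap, look_append_castAdd, h]
    rfl

instance Bd.ball {P : M.Num → (Fin k → M.Num) → Prop} {f : (Fin k → M.Num) → M.Num}
    [hf : Tm f] [hP : Bd (fun x : Fin (k + 1) → M.Num => P (x 0) (fun i => x i.succ))] :
    Bd (fun x => ∀ a, a < f x → P a x) := by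
  obtain ⟨n, m, t, φ, env, v, hφ, h, h'⟩ := hP.normal_bound hf
  refine ⟨n, m, _, env, v, .ball t hφ, fun x => ?_⟩
  simp only [Realize, termVal_lift, h, h']
  rfl

instance Bd.bex {P : M.Num → (Fin k → M.Num) → Prop} {f : (Fin k → M.Num) → M.Num}
    [hf : Tm f] [hP : Bd (fun x : Fin (k + 1) → M.Num => P (x 0) (fun i => x i.succ))] :
    Bd (fun x => ∃ a, a < f x ∧ P a x) := by
  obtain ⟨n, m, t, φ, env, v, hφ, h, h'⟩ := hP.normal_bound hf
  refine ⟨n, m, _, env, v, .bex t hφ, fun x => ?_⟩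
  simp only [Realize, termVal_lift, h, h']
  rfl

theorem Sig.of_bd {P : M.Num → (Fin k → M.Num) → Prop}
    (hP : Bd (fun x : Fin (k + 1) → M.Num => P (x 0) (fun i => x i.succ))) :
    Sig (fun x => ∃ a, P a x) := by
  obtain ⟨n, m, φ, env, v, hφ, h⟩ := Rep.normal (fun _ _ _ h => h.rename _ _) hP.out
  exact ⟨n, m, .exNum φ, env, v, ⟨φ, hφ, rfl⟩, fun x => by simp only [Realize, h]⟩

theorem Sig.exists_bd (hP : Sig P) : ∃ Q : M.Num → (Fin k → M.Num) → Prop,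
    Bd (fun x : Fin (k + 1) → M.Num => Q (x 0) (fun i => x i.succ)) ∧ ∀ x, P x ↔ ∃ a, Q a x := by
  obtain ⟨n, m, _, env, v, ⟨θ, hθ, rfl⟩, h⟩ := hP.out
  refine ⟨fun a x => M.Realize θ (Fin.cons a (look env x)) v, ⟨n + 1, m, θ,
    Fin.cons (.inl 0) (fun i => (env i).map Fin.succ id), v, hθ, fun x => ?_⟩, fun x => h x⟩
  have : (Fin.cons (x 0) (look env fun i => x i.succ) : Fin (n + 1) → M.Num) =
      look (Fin.cons (.inl 0) (fun i => (env i).map Fin.succ id)) x := by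
    funext i
    refine Fin.cases ?_ (fun j => ?_) i
    · simp [look]
    · rcases h : env j <;> simp [look, h]
  beta_reduce
  rw [this]

theorem Sig.comp {l : ℕ} (hP : Sig P) (ρ : Fin k → Fin l) : Sig (fun x => P (fun i => x (ρ i))) :=
  ⟨hP.out.comp ρ⟩

end Bounded

/-! ### Induction and comprehension for definable relations -/

theorem Sigma01Induction.sig (hM : M.Sigma01Induction) {P : M.Num → Prop}
    (hP : Sig (fun x : Fin 1 → M.Num => P (x 0))) (h0 : P 0) (h1 : ∀ a, P a → P (a + 1))
    (a : M.Num) : P a := by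
  obtain ⟨n, m, φ, env, v, hφ, h⟩ := Rep.normal (P := fun a (_ : Fin 0 → M.Num) => P a)
    (fun _ _ _ h => h.rename _ _) hP.out
  have := hM n m φ hφ (look env Fin.elim0) v ((h 0 Fin.elim0).1 h0)
    (fun a ha => (h (a + 1) Fin.elim0).1 (h1 a ((h a Fin.elim0).2 ha))) a
  exact (h a Fin.elim0).2 this

theorem Sigma01Induction.bd (hM : M.Sigma01Induction) {P : M.Num → Prop}
    (hP : Bd (fun x : Fin 1 → M.Num => P (x 0))) (h0 : P 0) (h1 : ∀ a, P a → P (a + 1))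
    (a : M.Num) : P a := by
  refine hM.sig ?_ h0 h1 a
  have := Sig.of_bd (P := fun _ (x : Fin 1 → M.Num) => P (x 0)) (hP.comp Fin.succ)
  have e : (fun x : Fin 1 → M.Num => P (x 0)) = fun x => ∃ _ : M.Num, P (x 0) := by
    funext x
    exact propext ⟨fun h => ⟨0, h⟩, fun ⟨_, h⟩ => h⟩
  rwa [e]

theorem Delta01Comprehension.exists_set (hM : M.Delta01Comprehension) {P : M.Num → Prop}
    (hP : Sig (fun x : Fin 1 → M.Num => P (x 0))) (hN : Sig (fun x : Fin 1 → M.Num => ¬ P (x 0))) :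
    {a | P a} ∈ M.sets := by
  obtain ⟨n, m, φ, ψ, env, v, hφ, ⟨θ, hθ, rfl⟩, h, h'⟩ := Rep.merge (fun _ _ _ h => h.rename _ _)
    (fun _ _ _ h => h.rename _ _) hP.out hN.out
  obtain ⟨ρ, env', hρ⟩ := exists_normal env
  -- The `Π⁰₁` side negates the matrix `θ` of the `Σ⁰₁` definition of the complement.
  obtain ⟨X, hX, hX'⟩ := hM n m (φ.rename ρ id)
    ((Formula.allNum (.neg θ)).rename ρ id) (hφ.rename _ _)
    (Formula.IsPi01.rename ⟨_, .neg hθ, rfl⟩ _ _) (look env' Fin.elim0) v fun a => by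
      rw [realize_rename, realize_rename, hρ, Function.comp_id, ← h]
      have := h' (Fin.cons a Fin.elim0)
      simp only [Realize] at this ⊢
      rw [← not_exists, ← this]
      simp
  convert hX
  ext a
  rw [hX', realize_rename, hρ, Function.comp_id, ← h]
  rfl

end L2Structure

/-! ### Arithmetic in a model: the ordered semiring of numbers -/

namespace L2Structure

open SecondOrderArithmetic

/-- `M` is a model of `RCA₀`, as a class. -/
class IsRCA0 (M : L2Structure.{u}) : Prop where
  out : M.IsModelRCA0

variable {M : L2Structure.{u}} [hM : M.IsRCA0]

theorem num_bd_ind {P : M.Num → Prop} (h0 : P 0) (h1 : ∀ a, P a → P (a + 1)) (a : M.Num)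
    (hP : Bd (fun x : Fin 1 → M.Num => P (x 0)) := by infer_instance) : P a :=
  hM.out.sigma01_induction.bd hP h0 h1 a

theorem num_add_zero (a : M.Num) : a + 0 = a := hM.out.basic.add_zero a

theorem num_add_succ (a b : M.Num) : a + (b + 1) = a + b + 1 := hM.out.basic.add_succ a b

theorem num_mul_zero (a : M.Num) : a * 0 = 0 := hM.out.basic.mul_zero a

theorem num_mul_succ (a b : M.Num) : a * (b + 1) = a * b + a := hM.out.basic.mul_succ a b

theorem num_lt_succ {a b : M.Num} : a < b + 1 ↔ a < b ∨ a = b := hM.out.basic.lt_succ_iff a b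

theorem num_zero_add (a : M.Num) : 0 + a = a :=
  num_bd_ind (P := fun a : M.Num => 0 + a = a) (num_add_zero 0)
    (fun a h => by rw [num_add_succ, h]) a

theorem num_add_assoc (a b c : M.Num) : a + b + c = a + (b + c) :=
  num_bd_ind (P := fun c => a + b + c = a + (b + c)) (by rw [num_add_zero, num_add_zero])
    (fun c h => by rw [num_add_succ, num_add_succ, num_add_succ, h]) c

theorem num_succ_add (a b : M.Num) : a + 1 + b = a + b + 1 :=
  num_bd_ind (P := fun b => a + 1 + b = a + b + 1) (by rw [num_add_zero, num_add_zero])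
    (fun c h => by rw [num_add_succ, num_add_succ, h]) b

theorem num_add_comm (a b : M.Num) : a + b = b + a :=
  num_bd_ind (P := fun b => a + b = b + a) (by rw [num_add_zero, num_zero_add])
    (fun c h => by rw [num_add_succ, num_succ_add, h]) b

theorem num_zero_mul (a : M.Num) : 0 * a = 0 :=
  num_bd_ind (P := fun a : M.Num => 0 * a = 0) (num_mul_zero 0)
    (fun a h => by rw [num_mul_succ, h, num_add_zero]) a

theorem num_succ_mul (a b : M.Num) : (a + 1) * b = a * b + b :=
  num_bd_ind (P := fun b => (a + 1) * b = a * b + b)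
    (by rw [num_mul_zero, num_mul_zero, num_add_zero])
    (fun b h => by
      rw [num_mul_succ, num_mul_succ, h, num_add_assoc, num_add_assoc, num_add_succ, num_add_succ,
        num_add_comm b a, num_add_assoc, num_add_assoc]) b

theorem num_mul_comm (a b : M.Num) : a * b = b * a :=
  num_bd_ind (P := fun b => a * b = b * a) (by rw [num_mul_zero, num_zero_mul])
    (fun c h => by rw [num_mul_succ, num_succ_mul, h]) b

theorem num_mul_add (a b c : M.Num) : a * (b + c) = a * b + a * c :=
  num_bd_ind (P := fun c => a * (b + c) = a * b + a * c)
    (by rw [num_mul_zero, num_add_zero, num_add_zero])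
    (fun c h => by rw [num_add_succ, num_mul_succ, num_mul_succ, h, num_add_assoc]) c

theorem num_mul_assoc (a b c : M.Num) : a * b * c = a * (b * c) :=
  num_bd_ind (P := fun c => a * b * c = a * (b * c)) (by simp only [num_mul_zero])
    (fun c h => by rw [num_mul_succ, num_mul_succ, num_mul_add, h]) c

theorem num_mul_one (a : M.Num) : a * 1 = a := by
  rw [← num_zero_add 1, num_mul_succ, num_mul_zero, num_zero_add]

instance : CommSemiring M.Num where
  add_assoc := num_add_assoc
  zero_add := num_zero_add
  add_zero := num_add_zero
  add_comm := num_add_comm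
  left_distrib := num_mul_add
  right_distrib a b c := by
    rw [num_mul_comm, num_mul_add, num_mul_comm c, num_mul_comm c]
  zero_mul := num_zero_mul
  mul_zero := num_mul_zero
  mul_assoc := num_mul_assoc
  one_mul a := by rw [num_mul_comm, num_mul_one]
  mul_one := num_mul_one
  mul_comm := num_mul_comm
  nsmul := nsmulRec

theorem num_add_left_cancel {a b c : M.Num} : a + b = a + c → b = c :=
  num_bd_ind (P := fun a => a + b = a + c → b = c) (by simp only [zero_add]; exact id)
    (fun a h h' => h (hM.out.basic.succ_inj _ _ (by rwa [num_succ_add, num_succ_add] at h'))) a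

theorem num_succ_lt_succ {a b : M.Num} : a < b → a + 1 < b + 1 :=
  num_bd_ind (P := fun b => a < b → a + 1 < b + 1) (fun h => absurd h (hM.out.basic.not_lt_zero a))
    (fun b ih h => by
      rcases num_lt_succ.1 h with h | rfl
      · exact num_lt_succ.2 (.inl (ih h))
      · exact num_lt_succ.2 (.inr rfl)) b

theorem num_lt_iff {a b : M.Num} : a < b ↔ ∃ c, b = a + c + 1 := by
  constructor
  -- The bound on the witness `c` is there only to make the induction formula bounded.
  · have := num_bd_ind (P := fun b => a < b → ∃ c, c < b + 1 ∧ b = a + c + 1)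
      (fun h => absurd h (hM.out.basic.not_lt_zero a))
      (fun b ih h => by
        rcases num_lt_succ.1 h with h | rfl
        · obtain ⟨c, hc, h⟩ := ih h
          exact ⟨c + 1, num_succ_lt_succ hc, by rw [← add_assoc, ← h]⟩
        · refine ⟨0, ?_, by rw [add_zero]⟩
          exact num_bd_ind (P := fun a : M.Num => 0 < a + 1 + 1)
            (num_lt_succ.2 (.inl (num_lt_succ.2 (.inr rfl))))
            (fun a h => num_lt_succ.2 (.inl h)) a) b
    exact fun h => (this h).imp fun _ h => h.2
  · rintro ⟨c, rfl⟩
    exact num_bd_ind (P := fun c => a < a + c + 1) (num_lt_succ.2 (.inr (add_zero a).symm))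
      (fun c h => num_lt_succ.2 (.inl (by rwa [← add_assoc]))) c

theorem num_cases (a : M.Num) : a = 0 ∨ ∃ b, a = b + 1 := by
  have := num_bd_ind (P := fun a : M.Num => a = 0 ∨ ∃ b, b < a ∧ a = b + 1) (.inl rfl)
    (fun a _ => .inr ⟨a, num_lt_succ.2 (.inr rfl), rfl⟩) a
  exact this.imp id fun ⟨b, h⟩ => ⟨b, h.2⟩

theorem num_trichotomy (a b : M.Num) : a < b ∨ a = b ∨ b < a := by
  refine num_bd_ind (P := fun b => a < b ∨ a = b ∨ b < a) ?_ ?_ b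
  · rcases num_cases a with rfl | ⟨c, rfl⟩
    · exact .inr (.inl rfl)
    · exact .inr (.inr (num_lt_iff.2 ⟨c, by rw [zero_add]⟩))
  · rintro b (h | rfl | h)
    · exact .inl (num_lt_succ.2 (.inl h))
    · exact .inl (num_lt_succ.2 (.inr rfl))
    · obtain ⟨c, rfl⟩ := num_lt_iff.1 h
      rcases num_cases c with rfl | ⟨d, rfl⟩
      · exact .inr (.inl (by rw [add_zero]))
      · exact .inr (.inr (num_lt_iff.2 ⟨d, by ring⟩))

theorem num_lt_irrefl (a : M.Num) : ¬ a < a := fun h => by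
  obtain ⟨c, h⟩ := num_lt_iff.1 h
  rw [add_assoc] at h
  exact hM.out.basic.succ_ne_zero c (num_add_left_cancel (h.symm.trans (add_zero a).symm))

theorem num_lt_trans {a b c : M.Num} (h : a < b) (h' : b < c) : a < c := by
  obtain ⟨d, rfl⟩ := num_lt_iff.1 h
  obtain ⟨e, rfl⟩ := num_lt_iff.1 h'
  exact num_lt_iff.2 ⟨d + 1 + e, by ring⟩

noncomputable instance : LinearOrder M.Num where
  le a b := a < b ∨ a = b
  le_refl a := .inr rfl
  le_trans a b c := by
    rintro (h | rfl) (h' | rfl)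
    · exact .inl (num_lt_trans h h')
    · exact .inl h
    · exact .inl h'
    · exact .inr rfl
  lt_iff_le_not_ge a b := by
    constructor
    · refine fun h => ⟨.inl h, ?_⟩
      rintro (h' | rfl)
      · exact num_lt_irrefl _ (num_lt_trans h h')
      · exact num_lt_irrefl _ h
    · rintro ⟨h | rfl, h'⟩
      · exact h
      · exact absurd (.inr rfl) h'
  le_antisymm a b := by
    rintro (h | rfl) (h' | h')
    · exact absurd (num_lt_trans h h') (num_lt_irrefl _)
    · exact h'.symm
    · rfl
    · rfl
  le_total a b := by
    rcases num_trichotomy a b with h | h | h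
    · exact .inl (.inl h)
    · exact .inl (.inr h)
    · exact .inr (.inl h)
  toDecidableLE := Classical.decRel _

theorem num_lt_succ_iff_le {a b : M.Num} : a < b + 1 ↔ a ≤ b := num_lt_succ

theorem num_le_iff {a b : M.Num} : a ≤ b ↔ ∃ c, b = a + c := by
  rw [← num_lt_succ_iff_le, num_lt_iff]
  exact exists_congr fun c => ⟨fun h => hM.out.basic.succ_inj _ _ h, fun h => by rw [h]⟩

instance : CanonicallyOrderedAdd M.Num where
  exists_add_of_le h := num_le_iff.1 h
  le_self_add _ b := num_le_iff.2 ⟨b, rfl⟩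
  le_add_self _ b := num_le_iff.2 ⟨b, add_comm _ _⟩

instance : IsOrderedCancelAddMonoid M.Num where
  add_le_add_left a b h c := by
    obtain ⟨d, rfl⟩ := num_le_iff.1 h
    exact num_le_iff.2 ⟨d, by ring⟩
  le_of_add_le_add_left a b c h := by
    obtain ⟨d, h⟩ := num_le_iff.1 h
    rw [add_assoc] at h
    exact num_le_iff.2 ⟨d, num_add_left_cancel h⟩

theorem num_zero_lt_one : (0 : M.Num) < 1 := num_lt_iff.2 ⟨0, by simp only [zero_add]⟩

instance : Nontrivial M.Num := ⟨0, 1, num_zero_lt_one.ne⟩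

theorem num_mul_pos {a b : M.Num} (ha : 0 < a) (hb : 0 < b) : 0 < a * b := by
  obtain ⟨c, rfl⟩ := num_lt_iff.1 ha
  obtain ⟨d, rfl⟩ := num_lt_iff.1 hb
  exact num_lt_iff.2 ⟨c * d + c + d, by ring⟩

theorem num_mul_lt_mul {a b c : M.Num} (ha : 0 < a) (h : b < c) : a * b < a * c := by
  obtain ⟨d, rfl⟩ := num_lt_iff.1 h
  have := num_mul_pos ha (num_lt_iff.2 ⟨d, by rw [zero_add]⟩ : 0 < d + 1)
  rw [add_assoc, mul_add]
  exact lt_add_of_pos_right _ this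

instance : IsStrictOrderedRing M.Num where
  zero_le_one := num_zero_lt_one.le
  mul_lt_mul_of_pos_left _ ha _ _ h := num_mul_lt_mul ha h
  mul_lt_mul_of_pos_right a ha b c h := by
    rw [mul_comm b, mul_comm c]
    exact num_mul_lt_mul ha h

theorem num_succ_le_iff {a b : M.Num} : a + 1 ≤ b ↔ a < b := by
  rw [← num_lt_succ_iff_le]
  exact add_lt_add_iff_right 1

theorem num_lt_succ_self (a : M.Num) : a < a + 1 := num_lt_succ_iff_le.2 le_rfl

/-! ### The pairing function -/

theorem left_le_pair (a b : M.Num) : a ≤ pair a b := by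
  unfold pair
  exact le_add_self

theorem num_le_mul_self (a : M.Num) : a ≤ a * a := by
  rcases num_cases a with rfl | ⟨b, rfl⟩
  · exact zero_le
  · exact le_mul_of_one_le_right zero_le le_add_self

theorem right_le_pair (a b : M.Num) : b ≤ pair a b := by
  unfold pair
  exact (le_add_self.trans (num_le_mul_self (a + b))).trans le_self_add

theorem pair_add_le {a b c d : M.Num} (h : pair a b = pair c d) : a + b ≤ c + d := by
  by_contra! hlt
  obtain ⟨e, he⟩ := num_lt_iff.1 hlt
  refine absurd h (ne_of_gt ?_)
  unfold pair
  rw [he]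
  -- The witness is one less than the difference of `(c + d + e + 1)² + a` and `(c + d)² + c`.
  refine num_lt_iff.2 ⟨a + 2 * e * (c + d) + e * e + 2 * e + c + 2 * d, ?_⟩
  ring

theorem pair_injective {a b c d : M.Num} (h : pair a b = pair c d) : a = c ∧ b = d := by
  have hs : a + b = c + d := le_antisymm (pair_add_le h) (pair_add_le h.symm)
  unfold pair at h
  rw [hs] at h
  have ha := add_left_cancel h
  exact ⟨ha, by rw [ha] at hs; exact add_left_cancel hs⟩

/-! ### `Σ⁰₁` relations -/

section

variable {k : ℕ} {P Q : (Fin k → M.Num) → Prop} {f g : (Fin k → M.Num) → M.Num}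

instance Tm.pair [Tm f] [Tm g] : Tm (fun x => pair (f x) (g x)) :=
  inferInstanceAs (Tm (fun x => (f x + g x) * (f x + g x) + f x))

theorem Bd.const (p : Prop) : Bd (fun _ : Fin k → M.Num => p) := by
  by_cases h : p
  · simpa [h] using (inferInstance : Bd (fun _ : Fin k → M.Num => (0 : M.Num) = 0))
  · simpa [h] using (inferInstance : Bd (fun _ : Fin k → M.Num => ¬ (0 : M.Num) = 0))

/-- Instead of substituting a term in a formula, the value is named by a quantifier bounded by `f x
+ 1`. -/
theorem Bd.subst {P : M.Num → (Fin k → M.Num) → Prop}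
    (hP : Bd (fun x : Fin (k + 1) → M.Num => P (x 0) (fun i => x i.succ))) (hf : Tm f) :
    Bd (fun x => P (f x) x) := by
  have hf' : Tm (fun x : Fin (k + 1) → M.Num => f (fun i => x i.succ)) := by
    obtain ⟨n, t, env, h⟩ := hf.out
    refine ⟨n, t, fun i => (env i).map Fin.succ id, fun x => ?_⟩
    rw [h]
    congr 1
    funext i
    rcases h : env i <;> simp [look, h]
  have : (fun x => P (f x) x) = fun x => ∃ a, a < f x + 1 ∧ (a = f x ∧ P a x) := by
    funext x
    refine propext ⟨fun h => ⟨f x, num_lt_succ_self _, rfl, h⟩, ?_⟩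
    rintro ⟨_, -, rfl, h⟩
    exact h
  rw [this]
  infer_instance

theorem Sig.of_bd_self (hP : Bd P) : Sig P := by
  have := Sig.of_bd (P := fun _ x => P x) (hP.comp Fin.succ)
  simpa only [exists_const] using this

theorem Sig.ex {P : M.Num → (Fin k → M.Num) → Prop}
    (hP : Sig (fun x : Fin (k + 1) → M.Num => P (x 0) (fun i => x i.succ))) :
    Sig (fun x => ∃ a, P a x) := by
  obtain ⟨Q, hQ, h⟩ := hP.exists_bd
  have hQ' : Bd (fun z : Fin (k + 3) → M.Num =>
      Q (z 0) (Fin.cons (z 1) (fun i => z i.succ.succ.succ))) := by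
    convert hQ.comp (Fin.cons 0 (Fin.cons 1 (fun i => i.succ.succ.succ)) :
      Fin (k + 2) → Fin (k + 3)) using 3 with z
    · rfl
    · funext i
      refine Fin.cases ?_ (fun j => ?_) i <;> rfl
  -- Two unbounded quantifiers are merged into one, over a common bound `c` of both witnesses.
  have e : (fun x => ∃ a, P a x) = fun x => ∃ c, ∃ a, a < c ∧ ∃ b, b < c ∧ Q b (Fin.cons a x) := by
    funext x
    refine propext ⟨?_, ?_⟩
    · rintro ⟨a, ha⟩
      obtain ⟨b, hb⟩ := (h (Fin.cons a x)).1 (by simpa using ha)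
      exact ⟨a + b + 1, a, num_lt_succ_iff_le.2 le_self_add, b, num_lt_succ_iff_le.2 le_add_self,
        hb⟩
    · rintro ⟨c, a, -, b, -, hb⟩
      exact ⟨a, by simpa using (h (Fin.cons a x)).2 ⟨b, hb⟩⟩
  rw [e]
  refine Sig.of_bd (P := fun c x => ∃ a, a < c ∧ ∃ b, b < c ∧ Q b (Fin.cons a x)) ?_
  have : Bd (fun y : Fin (k + 1) → M.Num => ∃ a, a < y 0 ∧ ∃ b, b < y 0 ∧
    Q b (Fin.cons a (fun i => y i.succ))) := Bd.bex (hP := Bd.bex (hP := hQ'))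
  exact this

theorem Sig.and (hP : Sig P) (hQ : Sig Q) : Sig (fun x => P x ∧ Q x) := by
  obtain ⟨P', hP', h⟩ := hP.exists_bd
  obtain ⟨Q', hQ', h'⟩ := hQ.exists_bd
  have e : (fun x => P x ∧ Q x) = fun x => ∃ a b, P' a x ∧ Q' b x := by
    funext x
    rw [h, h', exists_and_exists_comm]
  have h1 : Bd (fun x : Fin (k + 2) → M.Num => P' (x 1) (fun i => x i.succ.succ)) :=
    hP'.comp (Fin.succ)
  have h2 : Bd (fun x : Fin (k + 2) → M.Num => Q' (x 0) (fun i => x i.succ.succ)) :=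
    hQ'.comp (Fin.cons 0 (fun i => i.succ.succ) : Fin (k + 1) → Fin (k + 2))
  rw [e]
  exact Sig.ex (Sig.of_bd (P := fun b (x : Fin (k + 1) → M.Num) =>
    P' (x 0) (fun i => x i.succ) ∧ Q' b (fun i => x i.succ)) (@Bd.and _ _ _ _ h1 h2))

theorem Sig.or (hP : Sig P) (hQ : Sig Q) : Sig (fun x => P x ∨ Q x) := by
  obtain ⟨P', hP', h⟩ := hP.exists_bd
  obtain ⟨Q', hQ', h'⟩ := hQ.exists_bd
  have e : (fun x => P x ∨ Q x) = fun x => ∃ a, P' a x ∨ Q' a x := by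
    funext x
    rw [h, h', exists_or]
  rw [e]
  exact Sig.of_bd (P := fun a x => P' a x ∨ Q' a x) Bd.or

/-! ### `Δ⁰₁` relations and functions -/

/-- Relations that are `Δ⁰₁` with parameters. -/
class Dec {k : ℕ} (P : (Fin k → M.Num) → Prop) : Prop where
  pos : Sig P
  neg : Sig (fun x => ¬ P x)

/-- Functions whose graph is `Σ⁰₁` with parameters. -/
class Fn {k : ℕ} (f : (Fin k → M.Num) → M.Num) : Prop where
  out : Sig (fun x : Fin (k + 1) → M.Num => x 0 = f (fun i => x i.succ))

theorem Dec.of_bd (hP : Bd P) : Dec P := ⟨.of_bd_self hP, .of_bd_self inferInstance⟩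

theorem Sig.subst {P : M.Num → (Fin k → M.Num) → Prop}
    (hP : Sig (fun x : Fin (k + 1) → M.Num => P (x 0) (fun i => x i.succ))) (hf : Fn f) :
    Sig (fun x => P (f x) x) := by
  simpa only [exists_eq_left] using Sig.ex (P := fun a x => a = f x ∧ P a x) (hf.out.and hP)

/-- As `f` is total, `¬ P (f x) x` is again of the form `∃ a, a = f x ∧ …`, so a `Σ⁰₁` graph
suffices on both sides. -/
theorem Dec.subst {P : M.Num → (Fin k → M.Num) → Prop}
    (hP : Dec (fun x : Fin (k + 1) → M.Num => P (x 0) (fun i => x i.succ))) (hf : Fn f) :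
    Dec (fun x => P (f x) x) :=
  ⟨hP.pos.subst hf, Sig.subst (P := fun a x => ¬ P a x) hP.neg hf⟩

theorem Dec.comp {l : ℕ} (hP : Dec P) (ρ : Fin k → Fin l) : Dec (fun x => P (fun i => x (ρ i))) :=
  ⟨hP.pos.comp ρ, hP.neg.comp ρ⟩

theorem Fn.comp {l : ℕ} (hf : Fn f) (ρ : Fin k → Fin l) : Fn (fun x => f (fun i => x (ρ i))) :=
  ⟨hf.out.comp (liftMap ρ)⟩

instance Fn.var (i : Fin k) : Fn (fun x : Fin k → M.Num => x i) :=
  ⟨.of_bd_self inferInstance⟩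

instance Fn.const (c : M.Num) : Fn (fun _ : Fin k → M.Num => c) :=
  ⟨.of_bd_self inferInstance⟩

theorem Dec.comp₁ {R : M.Num → Prop} (hR : Dec (fun x : Fin 1 → M.Num => R (x 0))) (hf : Fn f) :
    Dec (fun x => R (f x)) :=
  Dec.subst (P := fun a _ => R a) (hR.comp (fun _ => 0)) hf

theorem Dec.comp₂ {R : M.Num → M.Num → Prop} (hR : Dec (fun x : Fin 2 → M.Num => R (x 0) (x 1)))
    (hf : Fn f) (hg : Fn g) : Dec (fun x => R (f x) (g x)) :=
  Dec.subst (P := fun a x => R a (g x))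
    (Dec.subst (P := fun b (x : Fin (k + 1) → M.Num) => R (x 0) b) (hR.comp ![1, 0])
      (hg.comp Fin.succ)) hf

theorem Dec.comp₃ {R : M.Num → M.Num → M.Num → Prop} {h : (Fin k → M.Num) → M.Num}
    (hR : Dec (fun x : Fin 3 → M.Num => R (x 0) (x 1) (x 2)))
    (hf : Fn f) (hg : Fn g) (hh : Fn h) : Dec (fun x => R (f x) (g x) (h x)) :=
  Dec.subst (P := fun a x => R a (g x) (h x))
    (Dec.subst (P := fun b (x : Fin (k + 1) → M.Num) => R (x 0) b (h (fun i => x i.succ)))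
      (Dec.subst (P := fun c (x : Fin (k + 2) → M.Num) => R (x 1) (x 0) c) (hR.comp ![2, 1, 0])
      (hh.comp (fun i => i.succ.succ)))
      (hg.comp Fin.succ)) hf

theorem Fn.comp₁ {F : M.Num → M.Num} (hF : Fn (fun x : Fin 1 → M.Num => F (x 0))) (hf : Fn f) :
    Fn (fun x => F (f x)) :=
  ⟨Sig.subst (P := fun a (x : Fin (k + 1) → M.Num) => x 0 = F a) (hF.out.comp ![1, 0])
    (hf.comp Fin.succ)⟩

theorem Fn.comp₂ {F : M.Num → M.Num → M.Num} (hF : Fn (fun x : Fin 2 → M.Num => F (x 0) (x 1)))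
    (hf : Fn f) (hg : Fn g) : Fn (fun x => F (f x) (g x)) :=
  ⟨Sig.subst (P := fun a (x : Fin (k + 1) → M.Num) => x 0 = F a (g (fun i => x i.succ)))
    (Sig.subst (P := fun b (x : Fin (k + 2) → M.Num) => x 1 = F (x 0) b) (hF.out.comp ![2, 1, 0])
      (hg.comp (fun i => i.succ.succ))) (hf.comp Fin.succ)⟩

instance Fn.add [hf : Fn f] [hg : Fn g] : Fn (fun x => f x + g x) :=
  .comp₂ (F := fun a b => a + b) ⟨.of_bd_self inferInstance⟩ hf hg

instance Fn.mul [hf : Fn f] [hg : Fn g] : Fn (fun x => f x * g x) :=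
  .comp₂ (F := fun a b => a * b) ⟨.of_bd_self inferInstance⟩ hf hg

instance Fn.pair [hf : Fn f] [hg : Fn g] : Fn (fun x => L2Structure.pair (f x) (g x)) :=
  .comp₂ (F := fun a b => L2Structure.pair a b) ⟨.of_bd_self inferInstance⟩ hf hg

instance Dec.eq [hf : Fn f] [hg : Fn g] : Dec (fun x => f x = g x) :=
  .comp₂ (R := fun a b => a = b) (.of_bd inferInstance) hf hg

instance Dec.lt [hf : Fn f] [hg : Fn g] : Dec (fun x => f x < g x) :=
  .comp₂ (R := fun a b => a < b) (.of_bd inferInstance) hf hg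

instance Dec.mem [hf : Fn f] (X : M.sets) : Dec (fun x => f x ∈ (X : Set M.Num)) :=
  .comp₁ (R := fun a => a ∈ (X : Set M.Num)) (.of_bd inferInstance) hf

instance Dec.not [hP : Dec P] : Dec (fun x => ¬ P x) :=
  ⟨hP.neg, by simpa only [not_not] using hP.pos⟩

instance Dec.and [hP : Dec P] [hQ : Dec Q] : Dec (fun x => P x ∧ Q x) :=
  ⟨hP.pos.and hQ.pos, by simpa only [not_and_or] using hP.neg.or hQ.neg⟩

instance Dec.or [hP : Dec P] [hQ : Dec Q] : Dec (fun x => P x ∨ Q x) :=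
  ⟨hP.pos.or hQ.pos, by simpa only [not_or] using hP.neg.and hQ.neg⟩

instance Dec.imp [hP : Dec P] [hQ : Dec Q] : Dec (fun x => P x → Q x) := by
  simpa only [imp_iff_not_or] using (inferInstance : Dec (fun x => ¬ P x ∨ Q x))

instance Dec.iff [hP : Dec P] [hQ : Dec Q] : Dec (fun x => P x ↔ Q x) := by
  simpa only [iff_iff_implies_and_implies] using
    (inferInstance : Dec (fun x => (P x → Q x) ∧ (Q x → P x)))

theorem Dec.exists_set {P : M.Num → Prop} (hP : Dec (fun x : Fin 1 → M.Num => P (x 0))) :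
    {a | P a} ∈ M.sets :=
  hM.out.delta01_comprehension.exists_set hP.pos hP.neg

end

/-! ### Contraction of two arguments to one -/

/-- The relation `P`, with its first two arguments given by a pair. -/
def Contract {k : ℕ} (P : (Fin (k + 2) → M.Num) → Prop) : (Fin (k + 1) → M.Num) → Prop :=
  fun y => ∃ a b, y 0 = pair a b ∧ P (Fin.cons a (Fin.cons b (fun i => y i.succ)))

theorem Sig.contract {k : ℕ} {P : (Fin (k + 2) → M.Num) → Prop} (hP : Sig P) :
    Sig (Contract P) := by
  have hc : Sig (fun z : Fin (k + 3) → M.Num =>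
      P (Fin.cons (z 1) (Fin.cons (z 0) (fun i => z i.succ.succ.succ)))) := by
    convert hP.comp (Fin.cons 1 (Fin.cons 0 (fun i => i.succ.succ.succ)) :
      Fin (k + 2) → Fin (k + 3)) using 3 with z
    funext i
    refine Fin.cases ?_ (fun j => ?_) i
    · simp
    · refine Fin.cases ?_ (fun j => ?_) j <;> simp
  exact Sig.ex (Sig.ex ((Sig.of_bd_self (inferInstance :
    Bd (fun x : Fin (k + 3) → M.Num => x 2 = pair (x 1) (x 0)))).and hc))

/-- The complement is `Σ⁰₁` because a number outside the contraction either codes a pair that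
violates `P` or codes no pair at all, and the latter is a bounded property. -/
theorem Dec.contract {k : ℕ} {P : (Fin (k + 2) → M.Num) → Prop} (hP : Dec P) :
    Dec (Contract P) := by
  refine ⟨hP.pos.contract, ?_⟩
  have e : (fun y => ¬ Contract P y) = fun y => Contract (fun x => ¬ P x) y ∨
      ∀ a, a < y 0 + 1 → ∀ b, b < y 0 + 1 → ¬ y 0 = pair a b := by
    funext y
    refine propext ⟨fun h => ?_, ?_⟩
    · by_contra! hc
      obtain ⟨h1, a, -, b, -, h2⟩ := hc
      exact h1 ⟨a, b, h2, fun hp => h ⟨a, b, h2, hp⟩⟩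
    · rintro (⟨a, b, h1, h2⟩ | h) ⟨a', b', h1', h2'⟩
      · obtain ⟨rfl, rfl⟩ := pair_injective (h1.symm.trans h1')
        exact h2 h2'
      · exact h a' (num_lt_succ_iff_le.2 (h1'.symm ▸ left_le_pair _ _)) b'
          (num_lt_succ_iff_le.2 (h1'.symm ▸ right_le_pair _ _)) h1'
  rw [e]
  exact hP.neg.contract.or (.of_bd_self inferInstance)

theorem Bd.of_contract {k : ℕ} {P : (Fin (k + 2) → M.Num) → Prop} (hP : Bd (Contract P)) :
    Bd P := by
  have hs := Bd.subst (k := k + 2) (f := fun x => pair (x 0) (x 1))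
    (P := fun a x => Contract P (Fin.cons a (fun i => x i.succ.succ))) (by
      convert hP.comp (Fin.cons 0 (fun i => i.succ.succ.succ) : Fin (k + 1) → Fin (k + 3))
        using 2 with x
      rw [iff_iff_eq]
      congr 1
      funext i
      refine Fin.cases ?_ (fun j => ?_) i <;> rfl) inferInstance
  convert hs using 2 with x
  have hx : ∀ x : Fin (k + 2) → M.Num,
      (Fin.cons (x 0) (Fin.cons (x 1) (fun i => x i.succ.succ)) : Fin (k + 2) → M.Num) = x := by
    intro x
    funext i
    refine Fin.cases ?_ (fun j => ?_) i
    · simp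
    · refine Fin.cases ?_ (fun j => ?_) j <;> simp
  refine ⟨fun h => ⟨x 0, x 1, by simp, by simpa [hx] using h⟩, ?_⟩
  rintro ⟨a, b, h1, h2⟩
  obtain ⟨rfl, rfl⟩ := pair_injective (by simpa using h1)
  simpa [hx] using h2

theorem Bd.of_nullary (P : (Fin 0 → M.Num) → Prop) : Bd P := by
  have : P = fun _ => P Fin.elim0 := funext fun x => by rw [Subsingleton.elim x]
  rw [this]
  exact .const _

theorem Bd.of_unary {P : (Fin 1 → M.Num) → Prop} (hP : {a | P fun _ => a} ∈ M.sets) : Bd P := by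
  have := Bd.mem (f := fun x : Fin 1 → M.Num => x 0) ⟨_, hP⟩
  convert this using 2 with x
  change P x ↔ P (fun _ => x 0)
  rw [show (fun _ => x 0) = x from funext fun i => by rw [Subsingleton.elim i]]

theorem eq_const_apply {P : (Fin 1 → M.Num) → Prop} : (fun x => P (fun _ => x 0)) = P := by
  funext x
  rw [show (fun _ => x 0) = x from funext fun i => by rw [Subsingleton.elim i]]

/-- Pairing reduces the arity to one, where the relation is a set of the model by comprehension and
can serve as a parameter of an atomic formula. This closes `Δ⁰₁` relations under bounded quantifiers
without an appeal to collection. -/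
theorem Dec.bd : {k : ℕ} → {P : (Fin k → M.Num) → Prop} → Dec P → Bd P
  | 0, P, _ => .of_nullary P
  | 1, P, hP => .of_unary (Dec.exists_set (P := fun a => P fun _ => a) (by rwa [eq_const_apply]))
  | _ + 2, _, hP => .of_contract hP.contract.bd

/-- If all `Σ⁰₁` sets exist, then all `Σ⁰₁` relations are bounded, relative to suitable sets. -/
theorem Sig.bd_of_forall
    (H : ∀ P : M.Num → Prop, Sig (fun x : Fin 1 → M.Num => P (x 0)) → {a | P a} ∈ M.sets) :
    {k : ℕ} → {P : (Fin k → M.Num) → Prop} → Sig P → Bd P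
  | 0, P, _ => .of_nullary P
  | 1, P, hP => .of_unary (H (fun a => P fun _ => a) (by rwa [eq_const_apply]))
  | _ + 2, _, hP => .of_contract (hP.contract.bd_of_forall H)

section

variable {k : ℕ}

instance Dec.ball {P : M.Num → (Fin k → M.Num) → Prop} {f : (Fin k → M.Num) → M.Num}
    [hf : Fn f] [hP : Dec (fun x : Fin (k + 1) → M.Num => P (x 0) (fun i => x i.succ))] :
    Dec (fun x => ∀ a, a < f x → P a x) := by
  have h1 : Bd (fun x : Fin (k + 2) → M.Num => P (x 0) (fun i => x i.succ.succ)) :=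
    hP.bd.comp (Fin.cons 0 (fun i => i.succ.succ) : Fin (k + 1) → Fin (k + 2))
  have h2 : Bd (fun y : Fin (k + 1) → M.Num => ∀ a, a < y 0 → P a (fun i => y i.succ)) :=
    Bd.ball (hP := h1)
  exact Dec.subst (P := fun b x => ∀ a, a < b → P a x) (.of_bd h2) hf

instance Dec.ball_le {P : M.Num → (Fin k → M.Num) → Prop} {f : (Fin k → M.Num) → M.Num}
    [hf : Fn f] [hP : Dec (fun x : Fin (k + 1) → M.Num => P (x 0) (fun i => x i.succ))] :
    Dec (fun x => ∀ a, a ≤ f x → P a x) := by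
  simp only [← num_lt_succ_iff_le]
  infer_instance

instance Dec.bex {P : M.Num → (Fin k → M.Num) → Prop} {f : (Fin k → M.Num) → M.Num}
    [hf : Fn f] [hP : Dec (fun x : Fin (k + 1) → M.Num => P (x 0) (fun i => x i.succ))] :
    Dec (fun x => ∃ a, a < f x ∧ P a x) := by
  have := Dec.not (P := fun x => ∀ a, a < f x → ¬ P a x)
    (hP := Dec.ball (hP := Dec.not (P := fun x : Fin (k + 1) → M.Num =>
      P (x 0) (fun i => x i.succ))))
  simpa only [not_forall, not_not, exists_prop] using this

instance Dec.bex_le {P : M.Num → (Fin k → M.Num) → Prop} {f : (Fin k → M.Num) → M.Num}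
    [hf : Fn f] [hP : Dec (fun x : Fin (k + 1) → M.Num => P (x 0) (fun i => x i.succ))] :
    Dec (fun x => ∃ a, a ≤ f x ∧ P a x) := by
  simp only [← num_lt_succ_iff_le]
  infer_instance

end

instance Sig.of_dec {k : ℕ} {P : (Fin k → M.Num) → Prop} [hP : Dec P] : Sig P := hP.pos

instance Sig.ex_inst {k : ℕ} {P : M.Num → (Fin k → M.Num) → Prop}
    [hP : Sig (fun x : Fin (k + 1) → M.Num => P (x 0) (fun i => x i.succ))] :
    Sig (fun x => ∃ a, P a x) :=
  .ex hP

/-! ### Induction -/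

theorem sig_ind {P : M.Num → Prop} (hP : Sig (fun x : Fin 1 → M.Num => P (x 0)))
    (h0 : P 0) (h1 : ∀ a, P a → P (a + 1)) (a : M.Num) : P a :=
  hM.out.sigma01_induction.sig hP h0 h1 a

theorem dec_ind {P : M.Num → Prop} (h0 : P 0) (h1 : ∀ a, P a → P (a + 1)) (a : M.Num)
    (hP : Dec (fun x : Fin 1 → M.Num => P (x 0)) := by infer_instance) : P a :=
  sig_ind hP.pos h0 h1 a

theorem dec_least {P : M.Num → Prop} (h : ∃ a, P a)
    (hP : Dec (fun x : Fin 1 → M.Num => P (x 0)) := by infer_instance) :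
    ∃ a, P a ∧ ∀ b, b < a → ¬ P b := by
  by_contra! hc
  obtain ⟨a, ha⟩ := h
  have h1 : Dec (fun x : Fin 2 → M.Num => P (x 0)) := hP.comp ![0]
  refine dec_ind (P := fun a => ∀ b, b < a → ¬ P b) (fun b hb => absurd hb not_lt_zero)
    (fun a ih b hb hPb => ?_) (a + 1) (Dec.ball (P := fun b _ => ¬ P b)) a
    (num_lt_succ_self a) ha
  rcases (num_lt_succ_iff_le.1 hb).lt_or_eq with hb | rfl
  · exact ih b hb hPb
  · obtain ⟨c, hc, hPc⟩ := hc b hPb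
    exact ih c hc hPc

/-- The greatest solution below `n` is the least upper bound of the solutions below `n`. -/
theorem dec_greatest {P : M.Num → Prop} {n : M.Num} (h : ∃ a, a < n ∧ P a)
    (hP : Dec (fun x : Fin 1 → M.Num => P (x 0)) := by infer_instance) :
    ∃ a, a < n ∧ P a ∧ ∀ b, b < n → P b → b ≤ a := by
  obtain ⟨a, ha, hPa⟩ := h
  have h1 : Dec (fun x : Fin 2 → M.Num => P (x 0)) := hP.comp ![0]
  obtain ⟨m, hm, hmin⟩ := dec_least (P := fun m => ∀ b, b < n → P b → b ≤ m)
    ⟨n, fun b hb _ => hb.le⟩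
  by_cases hmn : m < n ∧ P m
  · exact ⟨m, hmn.1, hmn.2, hm⟩
  · exfalso
    rcases num_cases m with rfl | ⟨d, rfl⟩
    · have := le_antisymm (hm a ha hPa) zero_le
      subst this
      exact hmn ⟨ha, hPa⟩
    · refine hmin d (num_lt_succ_self d) fun b hb hPb => ?_
      refine num_lt_succ_iff_le.1 (lt_of_le_of_ne (hm b hb hPb) ?_)
      rintro rfl
      exact hmn ⟨hb, hPb⟩

/-! ### Divisibility -/

theorem num_dvd_iff {a b : M.Num} : a ∣ b ↔ ∃ c, c ≤ b ∧ b = a * c := by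
  refine ⟨?_, fun ⟨c, _, h⟩ => ⟨c, h⟩⟩
  rintro ⟨c, rfl⟩
  rcases num_cases a with rfl | ⟨d, rfl⟩
  · exact ⟨0, zero_le, by simp only [zero_mul]⟩
  · exact ⟨c, le_mul_of_one_le_left zero_le le_add_self, rfl⟩

instance Dec.dvd {k : ℕ} {f g : (Fin k → M.Num) → M.Num} [hf : Fn f] [hg : Fn g] :
    Dec (fun x => f x ∣ g x) :=
  .comp₂ (R := fun a b => a ∣ b) (by simp only [num_dvd_iff]; infer_instance) hf hg

theorem num_dvd_of_dvd_add {a b c : M.Num} (h : a ∣ b) (h' : a ∣ b + c) : a ∣ c := by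
  obtain ⟨x, rfl⟩ := h
  obtain ⟨y, h⟩ := h'
  rcases zero_le.eq_or_lt (a := (0 : M.Num)) (b := a) with rfl | ha
  · rw [zero_mul, zero_mul, zero_add] at h
    rw [h]
  · have : x ≤ y := le_of_mul_le_mul_left (h ▸ le_self_add) ha
    obtain ⟨w, rfl⟩ := num_le_iff.1 this
    rw [mul_add] at h
    exact ⟨w, add_left_cancel h⟩

/-- With `p = m * (i + 1)`, a multiple of `n * (m * e)` is `n * p²`, and `p` is `-1` modulo `p + 1`.
Two uses of `num_dvd_of_dvd_add` replace the subtraction. -/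
theorem num_dvd_of_dvd_mul {m n i e : M.Num} (he : e ∣ m)
    (h : m * (i + 1) + 1 ∣ n * (m * e)) : m * (i + 1) + 1 ∣ n := by
  obtain ⟨w, rfl⟩ := he
  set m := e * w with hm
  set p := m * (i + 1) with hp
  have h1 : p + 1 ∣ n * (p * p) := by
    have := h.mul_right (w * (i + 1) * (i + 1))
    rwa [show n * (m * e) * (w * (i + 1) * (i + 1)) = n * (p * p) by rw [hp, hm]; ring] at this
  have h2 : p + 1 ∣ n * p :=
    num_dvd_of_dvd_add h1 ⟨n * p, by ring⟩
  exact num_dvd_of_dvd_add h2 ⟨n, by ring⟩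

/-- Distinct moduli `m * (i + 1) + 1` are coprime in effect: they differ by `m` times a positive
number that is at most `k` and hence divides `m`. -/
theorem num_dvd_of_dvd_mul_succ {m n k i l : M.Num} (hm : ∀ j, j ≤ k → 0 < j → j ∣ m)
    (hi : i < k) (hl : l < k) (hil : i ≠ l) (h : m * (i + 1) + 1 ∣ n * (m * (l + 1) + 1)) :
    m * (i + 1) + 1 ∣ n := by
  rcases hil.lt_or_gt with hlt | hlt
  · obtain ⟨e, rfl⟩ := num_lt_iff.1 hlt
    refine num_dvd_of_dvd_mul (hm (e + 1) ?_ ?_)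
      (num_dvd_of_dvd_add (b := n * (m * (i + 1) + 1)) (dvd_mul_left _ _) ?_)
    · exact le_trans (by rw [add_assoc]; exact le_add_self) hl.le
    · exact num_lt_iff.2 ⟨e, by rw [zero_add]⟩
    · rwa [show n * (m * (i + 1) + 1) + n * (m * (e + 1)) = n * (m * (i + e + 1 + 1) + 1) by ring]
  · obtain ⟨e, rfl⟩ := num_lt_iff.1 hlt
    refine num_dvd_of_dvd_mul (hm (e + 1) ?_ ?_)
      (num_dvd_of_dvd_add h ?_)
    · exact le_trans (by rw [add_assoc]; exact le_add_self) hi.le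
    · exact num_lt_iff.2 ⟨e, by rw [zero_add]⟩
    · exact ⟨n, by ring⟩

theorem exists_common_multiple (k : M.Num) : ∃ m, 0 < m ∧ ∀ j, j ≤ k → 0 < j → j ∣ m := by
  refine sig_ind (P := fun k : M.Num => ∃ m, 0 < m ∧ ∀ j, j ≤ k → 0 < j → j ∣ m)
    (by infer_instance) ?_ ?_ k
  · exact ⟨1, num_zero_lt_one, fun j hj hj' => absurd hj hj'.not_ge⟩
  · rintro k ⟨m, hm, h⟩
    refine ⟨m * (k + 1), num_mul_pos hm (num_lt_succ_iff_le.2 zero_le), fun j hj hj' => ?_⟩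
    rcases hj.lt_or_eq with hj | rfl
    · exact (h j (num_lt_succ_iff_le.1 hj) hj').mul_right _
    · exact dvd_mul_left _ _

/-- The number `n` is the product of the moduli that belong to the elements of `X` below `l`, built
by `Σ⁰₁` induction on `l`. Coprimality ensures that no other modulus with index below `k` divides
it. -/
theorem exists_coprime_product {k m : M.Num} (X : M.sets) (h0 : 0 < m)
    (hm : ∀ j, j ≤ k → 0 < j → j ∣ m) (l : M.Num) :
    ∃ n, l ≤ k → ∀ i, i < k → (m * (i + 1) + 1 ∣ n ↔ i ∈ (X : Set M.Num) ∧ i < l) := by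
  refine sig_ind (P := fun l : M.Num =>
    ∃ n, l ≤ k → ∀ i, i < k → (m * (i + 1) + 1 ∣ n ↔ i ∈ (X : Set M.Num) ∧ i < l))
    (by infer_instance) ?_ ?_ l
  · refine ⟨1, fun _ i _ => ⟨fun h => ?_, fun h => absurd h.2 not_lt_zero⟩⟩
    exfalso
    obtain ⟨q, _, hq⟩ := num_dvd_iff.1 h
    have hq0 : q ≠ 0 := by
      rintro rfl
      rw [mul_zero] at hq
      exact num_zero_lt_one.ne' hq
    have h1 : (m * (i + 1) + 1) * 1 ≤ (m * (i + 1) + 1) * q :=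
      mul_le_mul_of_nonneg_left (num_succ_le_iff.2 (pos_iff_ne_zero.2 hq0) |>.trans' (by simp))
        zero_le
    have h2 : 0 < m * (i + 1) := num_mul_pos h0 (num_lt_succ_iff_le.2 zero_le)
    rw [← hq, mul_one] at h1
    exact h1.not_gt (lt_add_of_pos_left _ h2)
  · rintro l ⟨n, ih⟩
    by_cases hl : l ∈ (X : Set M.Num)
    · refine ⟨n * (m * (l + 1) + 1), fun hlk i hi => ?_⟩
      have hlk' := num_succ_le_iff.1 hlk
      by_cases hil : i = l
      · subst hil
        exact ⟨fun _ => ⟨hl, num_lt_succ_self _⟩, fun _ => dvd_mul_left _ _⟩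
      · rw [num_lt_succ_iff_le, show i ≤ l ↔ i < l from ⟨fun h => h.lt_of_ne hil, le_of_lt⟩,
          ← ih hlk'.le i hi]
        exact ⟨num_dvd_of_dvd_mul_succ hm hi hlk' hil, fun h => h.mul_right _⟩
    · refine ⟨n, fun hlk i hi => ?_⟩
      rw [ih (num_succ_le_iff.1 hlk).le i hi, num_lt_succ_iff_le]
      refine and_congr_right fun hiX => ⟨le_of_lt, fun h => h.lt_of_ne ?_⟩
      rintro rfl
      exact hl hiX

/-! ### Codes of finite sets -/

theorem exists_inCode_iff (X : M.sets) (k : M.Num) :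
    ∃ c : M.Num, ∀ i, InCode i c ↔ i < k ∧ i ∈ (X : Set M.Num) := by
  obtain ⟨m, h0, hm⟩ := exists_common_multiple k
  obtain ⟨n, hn⟩ := exists_coprime_product X h0 hm k
  refine ⟨pair k (pair m n), fun i => ⟨?_, ?_⟩⟩
  · rintro ⟨k', m', n', he, hi, q, hq⟩
    obtain ⟨e1, he⟩ := pair_injective he
    obtain ⟨e2, e3⟩ := pair_injective he
    rw [← e2, ← e3] at hq
    rw [← e1] at hi
    exact ⟨hi, ((hn le_rfl i hi).1 ⟨q, by rw [mul_comm, hq]⟩).1⟩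
  · rintro ⟨hi, hX⟩
    obtain ⟨q, hq⟩ := (hn le_rfl i hi).2 ⟨hX, hi⟩
    exact ⟨k, m, n, rfl, hi, q, by rw [mul_comm, hq]⟩

theorem inCode_iff {i c : M.Num} : InCode i c ↔ ∃ k, k ≤ c ∧ ∃ m, m ≤ c ∧ ∃ n, n ≤ c ∧
    c = pair k (pair m n) ∧ i < k ∧ m * (i + 1) + 1 ∣ n := by
  constructor
  · rintro ⟨k, m, n, rfl, hi, q, hq⟩
    have := right_le_pair k (pair m n)
    exact ⟨k, left_le_pair _ _, m, (left_le_pair _ _).trans this, n, (right_le_pair _ _).trans this,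
      rfl, hi, q, by rw [← hq, mul_comm]⟩
  · rintro ⟨k, -, m, -, n, -, h, hi, q, hq⟩
    exact ⟨k, m, n, h, hi, q, by rw [hq, mul_comm]⟩

theorem lt_of_mem_elts {i c : M.Num} (h : i ∈ elts c) : i < c := by
  obtain ⟨k, m, n, rfl, hi, -⟩ := h
  exact hi.trans_le (left_le_pair _ _)

section

variable {k : ℕ} {f g h : (Fin k → M.Num) → M.Num}

instance Dec.mem_elts [hf : Fn f] [hg : Fn g] : Dec (fun x => f x ∈ elts (g x)) :=
  .comp₂ (R := fun i c => InCode i c) (by simp only [inCode_iff]; infer_instance) hf hg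

theorem elts_eq_iff {c d : M.Num} : elts c = elts d ↔
    ∀ i, i < c + d → (i ∈ elts c ↔ i ∈ elts d) := by
  refine ⟨fun h i _ => by rw [h], fun h => Set.ext fun i => ?_⟩
  by_cases hi : i < c + d
  · exact h i hi
  · exact ⟨fun h => absurd ((lt_of_mem_elts h).trans_le le_self_add) hi,
      fun h => absurd ((lt_of_mem_elts h).trans_le le_add_self) hi⟩

theorem isFinCode_iff {c : M.Num} : IsFinCode c ↔ ∀ d, d < c → elts d ≠ elts c :=
  forall₂_congr fun _ _ => not_congr Set.ext_iff.symm

instance Dec.elts_eq [hf : Fn f] [hg : Fn g] : Dec (fun x => elts (f x) = elts (g x)) :=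
  .comp₂ (R := fun c d => elts c = elts d) (by simp only [elts_eq_iff]; infer_instance) hf hg

instance Dec.isFinCode [hf : Fn f] : Dec (fun x => IsFinCode (f x)) :=
  .comp₁ (R := fun c => IsFinCode c)
    (by simp only [isFinCode_iff, ne_eq]; infer_instance) hf

end

theorem exists_isFinCode {X : Set M.Num} (hX : X ∈ M.sets) (n : M.Num) :
    ∃ c : M.Num, IsFinCode c ∧ ∀ i, i ∈ elts c ↔ i < n ∧ i ∈ X := by
  obtain ⟨d, hd⟩ := exists_inCode_iff ⟨X, hX⟩ n
  obtain ⟨c, hc, hmin⟩ := dec_least (P := fun c => elts c = elts d) ⟨d, rfl⟩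
  refine ⟨c, isFinCode_iff.2 fun b hb h => hmin b hb (h.trans hc), fun i => ?_⟩
  rw [hc]
  exact hd i

/-! ### Counting the elements of a finite set -/

/-- The set with code `w` contains, for `i ≤ a`, only those pairs `(i, r)` that are justified by
the recursive computation of the number of elements of `c` below `i`. -/
def Trace (c a w : M.Num) : Prop :=
  ∀ i, i ≤ a → ∀ r, r < w → pair i r ∈ elts w → (i = 0 ∧ r = 0) ∨
    ∃ j, j < i ∧ i = j + 1 ∧ ∃ s, s ≤ r ∧ pair j s ∈ elts w ∧
      ((j ∈ elts c ∧ r = s + 1) ∨ (¬ j ∈ elts c ∧ r = s))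

/-- The number of elements of `c` below `a` is `r`. -/
def CountRel (c a r : M.Num) : Prop := ∃ w, Trace c a w ∧ pair a r ∈ elts w

theorem Trace.dec {k : ℕ} {f g h : (Fin k → M.Num) → M.Num} [hf : Fn f] [hg : Fn g] [hh : Fn h] :
    Dec (fun x => Trace (f x) (g x) (h x)) :=
  .comp₃ (R := Trace) (by unfold Trace; infer_instance) hf hg hh

attribute [instance] Trace.dec

/-- Two traces agree by induction on the position, as each entry is justified by an earlier one. The
bounds `w` and `w'` on the entries keep the induction formula `Δ⁰₁`. -/
theorem CountRel.unique {c a r r' : M.Num} (h : CountRel c a r) (h' : CountRel c a r') :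
    r = r' := by
  obtain ⟨w, hw, hr⟩ := h
  obtain ⟨w', hw', hr'⟩ := h'
  have lt {i r w : M.Num} (h : pair i r ∈ elts w) : r < w :=
    (right_le_pair i r).trans_lt (lt_of_mem_elts h)
  refine dec_ind (P := fun i => i ≤ a → ∀ r, r < w → ∀ r', r' < w' → pair i r ∈ elts w →
    pair i r' ∈ elts w' → r = r') ?_ ?_ a (by infer_instance) le_rfl r (lt hr) r' (lt hr') hr hr'
  · intro ha r h1 r' h1' h2 h2'
    rcases hw 0 ha r h1 h2 with ⟨-, rfl⟩ | ⟨j, hj, -⟩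
    · rcases hw' 0 ha r' h1' h2' with ⟨-, rfl⟩ | ⟨j, hj, -⟩
      · rfl
      · exact absurd hj not_lt_zero
    · exact absurd hj not_lt_zero
  · intro i ih ha r h1 r' h1' h2 h2'
    have h0 : i + 1 ≠ 0 := hM.out.basic.succ_ne_zero i
    rcases hw _ ha r h1 h2 with ⟨h, -⟩ | ⟨j, -, hj, s, -, hs, h⟩
    · exact absurd h h0
    · obtain rfl := add_right_cancel hj
      rcases hw' _ ha r' h1' h2' with ⟨h, -⟩ | ⟨j, -, hj, s', -, hs', h'⟩
      · exact absurd h h0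
      · obtain rfl := add_right_cancel hj
        obtain rfl := ih ((num_lt_succ_self i).le.trans ha) s (lt hs) s' (lt hs') hs hs'
        grind

theorem CountRel.zero (c : M.Num) : CountRel c 0 0 := by
  obtain ⟨w, -, hw⟩ := exists_isFinCode (Dec.exists_set (P := fun p : M.Num => p = pair 0 0)
    inferInstance) (pair 0 0 + 1)
  simp only [num_lt_succ_iff_le, Set.mem_ofPred_eq] at hw
  refine ⟨w, fun i _ r _ h => .inl (pair_injective ((hw _).1 h).2), (hw _).2 ⟨le_rfl, rfl⟩⟩

theorem CountRel.succ {c a s r : M.Num} (h : CountRel c a s)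
    (hr : (a ∈ elts c ∧ r = s + 1) ∨ (¬ a ∈ elts c ∧ r = s)) : CountRel c (a + 1) r := by
  obtain ⟨v, hv, hs⟩ := h
  -- Entries of `v` at position `a + 1` are not constrained by `hv` and could be unjustified, so
  -- they are discarded before the new entry is added.
  have hS : {p | (p ∈ elts v ∧ ∀ r, r < v → p ≠ pair (a + 1) r) ∨ p = pair (a + 1) r} ∈ M.sets :=
    Dec.exists_set (P := fun p => (p ∈ elts v ∧ ∀ r, r < v → ¬ p = pair (a + 1) r) ∨
      p = pair (a + 1) r) inferInstance
  obtain ⟨w, -, hw⟩ := exists_isFinCode hS (v + pair (a + 1) r + 1)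
  simp only [num_lt_succ_iff_le, Set.mem_ofPred_eq] at hw
  have lt {i r w : M.Num} (h : pair i r ∈ elts w) : r < w :=
    (right_le_pair i r).trans_lt (lt_of_mem_elts h)
  have mem_of_le {i t : M.Num} (hi : i ≤ a) : pair i t ∈ elts w ↔ pair i t ∈ elts v := by
    rw [hw]
    have hne (r : M.Num) : pair i t ≠ pair (a + 1) r := fun h =>
      hi.not_gt ((pair_injective h).1 ▸ num_lt_succ_self a)
    refine ⟨fun h => h.2.elim And.left fun h => absurd h (hne _), fun h =>
      ⟨(lt_of_mem_elts h).le.trans le_self_add, .inl ⟨h, fun r _ => hne r⟩⟩⟩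
  refine ⟨w, fun i hi t ht hit => ?_, (hw _).2 ⟨le_add_self, .inr rfl⟩⟩
  rcases hi.lt_or_eq with hi | rfl
  · have hi := num_lt_succ_iff_le.1 hi
    rw [mem_of_le hi] at hit
    rcases hv i hi t (lt hit) hit with h | ⟨j, hj, hij, s', hs', hmem, h⟩
    · exact .inl h
    · exact .inr ⟨j, hj, hij, s', hs', (mem_of_le (hj.le.trans hi)).2 hmem, h⟩
  · rcases ((hw _).1 hit).2 with ⟨h, h'⟩ | h
    · exact absurd rfl (h' t (lt h))
    · obtain rfl := (pair_injective h).2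
      refine .inr ⟨a, num_lt_succ_self a, rfl, s, ?_, (mem_of_le le_rfl).2 hs, hr⟩
      rcases hr with ⟨-, rfl⟩ | ⟨-, rfl⟩
      · exact le_self_add
      · exact le_rfl

theorem CountRel.exists (c a : M.Num) : ∃ r, CountRel c a r := by
  refine sig_ind (P := fun a => ∃ r, CountRel c a r)
    (Sig.ex (by unfold CountRel; infer_instance)) ⟨0, .zero c⟩ ?_ a
  rintro a ⟨s, hs⟩
  by_cases ha : a ∈ elts c
  · exact ⟨_, hs.succ (.inl ⟨ha, rfl⟩)⟩
  · exact ⟨_, hs.succ (.inr ⟨ha, rfl⟩)⟩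

/-- The number of elements of `c` below `a`. -/
noncomputable def cnt (c a : M.Num) : M.Num := (CountRel.exists c a).choose

theorem countRel_cnt (c a : M.Num) : CountRel c a (cnt c a) := (CountRel.exists c a).choose_spec

instance Fn.cnt {k : ℕ} {f g : (Fin k → M.Num) → M.Num} [hf : Fn f] [hg : Fn g] :
    Fn (fun x => L2Structure.cnt (f x) (g x)) := by
  refine .comp₂ (F := fun c a => L2Structure.cnt c a) ⟨?_⟩ hf hg
  have : (fun x : Fin 3 → M.Num => x 0 =
        L2Structure.cnt ((fun i : Fin 2 => x i.succ) 0) ((fun i : Fin 2 => x i.succ) 1)) =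
      fun x => CountRel (x 1) (x 2) (x 0) := by
    funext x
    exact propext ⟨fun h => h ▸ countRel_cnt _ _, fun h => h.unique (countRel_cnt _ _)⟩
  rw [this]
  unfold CountRel
  infer_instance

variable {c d a b x : M.Num}

theorem cnt_zero (c : M.Num) : cnt c 0 = 0 := (countRel_cnt c 0).unique (.zero c)

theorem cnt_succ_of_mem (h : a ∈ elts c) : cnt c (a + 1) = cnt c a + 1 :=
  (countRel_cnt c (a + 1)).unique ((countRel_cnt c a).succ (.inl ⟨h, rfl⟩))

theorem cnt_succ_of_notMem (h : a ∉ elts c) : cnt c (a + 1) = cnt c a :=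
  (countRel_cnt c (a + 1)).unique ((countRel_cnt c a).succ (.inr ⟨h, rfl⟩))

theorem cnt_le (c a : M.Num) : cnt c a ≤ a := by
  refine dec_ind (P := fun a => cnt c a ≤ a) (cnt_zero c).le (fun a ih => ?_) a
  by_cases h : a ∈ elts c
  · rw [cnt_succ_of_mem h]
    exact add_le_add_left ih 1
  · rw [cnt_succ_of_notMem h]
    exact ih.trans le_self_add

theorem cnt_congr (h : ∀ i, i < a → (i ∈ elts c ↔ i ∈ elts d)) : cnt c a = cnt d a := by
  refine dec_ind (P := fun b => b ≤ a → cnt c b = cnt d b) (fun _ => by rw [cnt_zero, cnt_zero])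
    (fun b ih hb => ?_) a (by infer_instance) le_rfl
  have hb := num_succ_le_iff.1 hb
  by_cases hc : b ∈ elts c
  · rw [cnt_succ_of_mem hc, cnt_succ_of_mem ((h b hb).1 hc), ih hb.le]
  · rw [cnt_succ_of_notMem hc, cnt_succ_of_notMem (fun hd => hc ((h b hb).2 hd)), ih hb.le]

theorem cnt_mono_left (h : elts c ⊆ elts d) (a : M.Num) : cnt c a ≤ cnt d a := by
  refine dec_ind (P := fun b => cnt c b ≤ cnt d b) (by rw [cnt_zero, cnt_zero])
    (fun b ih => ?_) a
  by_cases hc : b ∈ elts c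
  · rw [cnt_succ_of_mem hc, cnt_succ_of_mem (h hc)]
    exact add_le_add_left ih 1
  · rw [cnt_succ_of_notMem hc]
    by_cases hd : b ∈ elts d
    · rw [cnt_succ_of_mem hd]
      exact ih.trans le_self_add
    · rwa [cnt_succ_of_notMem hd]

theorem cnt_add_one_le (h : elts c ⊆ elts d) (hc : x ∉ elts c) (hd : x ∈ elts d) (hx : x < a) :
    cnt c a + 1 ≤ cnt d a := by
  refine dec_ind (P := fun b => x < b → cnt c b + 1 ≤ cnt d b) (fun h => absurd h not_lt_zero)
    (fun b ih hb => ?_) a (by infer_instance) hx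
  rcases (num_lt_succ_iff_le.1 hb).lt_or_eq with hb | rfl
  · have ih := ih hb
    by_cases hbc : b ∈ elts c
    · rw [cnt_succ_of_mem hbc, cnt_succ_of_mem (h hbc)]
      exact add_le_add_left ih 1
    · rw [cnt_succ_of_notMem hbc]
      by_cases hd : b ∈ elts d
      · rw [cnt_succ_of_mem hd]
        exact ih.trans le_self_add
      · rwa [cnt_succ_of_notMem hd]
  · rw [cnt_succ_of_mem hd, cnt_succ_of_notMem hc]
    exact add_le_add_left (cnt_mono_left h x) 1

theorem cnt_stable (h : ∀ i, i ∈ elts c → i < a) (hab : a ≤ b) : cnt c b = cnt c a := by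
  refine dec_ind (P := fun b => a ≤ b → cnt c b = cnt c a) (fun h => ?_) (fun b ih hb => ?_)
    b (by infer_instance) hab
  · rw [le_antisymm h zero_le]
  · rcases hb.lt_or_eq with hb | rfl
    · have hb := num_lt_succ_iff_le.1 hb
      rw [cnt_succ_of_notMem (fun hm => hb.not_gt (h b hm)), ih hb]
    · rfl

theorem cnt_eq_add_one (hc : x ∉ elts c) (hd : x ∈ elts d) (hx : x < a)
    (h : ∀ i, i < a → i ≠ x → (i ∈ elts c ↔ i ∈ elts d)) : cnt d a = cnt c a + 1 := by
  refine dec_ind (P := fun b => b ≤ a → x < b → cnt d b = cnt c b + 1)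
    (fun _ h => absurd h not_lt_zero) (fun b ih hba hb => ?_) a (by infer_instance) le_rfl hx
  have hba := num_succ_le_iff.1 hba
  rcases (num_lt_succ_iff_le.1 hb).lt_or_eq with hb | rfl
  · have ih := ih hba.le hb
    by_cases hbc : b ∈ elts c
    · rw [cnt_succ_of_mem hbc, cnt_succ_of_mem ((h b hba hb.ne').1 hbc), ih]
    · rw [cnt_succ_of_notMem hbc, cnt_succ_of_notMem (fun hd => hbc ((h b hba hb.ne').2 hd)), ih]
  · rw [cnt_succ_of_mem hd, cnt_succ_of_notMem hc,
      cnt_congr fun i hi => h i (hi.trans hba) hi.ne]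

/-- The number of elements of the finite set with code `c`. -/
noncomputable def size (c : M.Num) : M.Num := cnt c c

theorem size_eq (h : ∀ i, i ∈ elts c → i < a) : size c = cnt c a := by
  rcases le_total a c with hac | hac
  · exact cnt_stable h hac
  · exact (cnt_stable (fun _ => lt_of_mem_elts) hac).symm

theorem size_lt_size (h : elts c ⊂ elts d) : size c < size d := by
  obtain ⟨x, hd, hc⟩ := Set.exists_of_ssubset h
  rw [size_eq (c := c) (a := d) (fun i hi => lt_of_mem_elts (h.1 hi)), size]
  exact num_succ_le_iff.1 (cnt_add_one_le h.1 hc hd (lt_of_mem_elts hd))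

instance Fn.size {k : ℕ} {f : (Fin k → M.Num) → M.Num} [hf : Fn f] :
    Fn (fun x => L2Structure.size (f x)) :=
  inferInstanceAs (Fn (fun x => L2Structure.cnt (f x) (f x)))

/-- Every unbounded set has initial segments of each finite size. -/
theorem exists_initSeg_size {X : Set M.Num} (hX : X ∈ M.sets) (hX' : IsUnbounded X) (k : M.Num) :
    ∃ c n, IsFinCode c ∧ (∀ i, i ∈ elts c ↔ i < n ∧ i ∈ X) ∧ size c = k := by
  lift X to M.sets using hX
  -- The bound on `i` brings the induction formula into `Σ⁰₁` form.
  have hb (c n : M.Num) : (∀ i, i ∈ elts c ↔ i < n ∧ i ∈ (X : Set M.Num)) ↔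
      ∀ i, i < c + n → (i ∈ elts c ↔ i < n ∧ i ∈ (X : Set M.Num)) := by
    refine ⟨fun h i _ => h i, fun h i => ?_⟩
    by_cases hi : i < c + n
    · exact h i hi
    · exact ⟨fun h => absurd ((lt_of_mem_elts h).trans_le le_self_add) hi,
        fun h => absurd (h.1.trans_le le_add_self) hi⟩
  refine sig_ind (P := fun k => ∃ c n, IsFinCode c ∧
    (∀ i, i ∈ elts c ↔ i < n ∧ i ∈ (X : Set M.Num)) ∧ size c = k) ?_ ?_ ?_ k
  · simp only [hb]
    exact Sig.ex inferInstance
  · obtain ⟨c, hc, h⟩ := exists_isFinCode X.2 0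
    refine ⟨c, 0, hc, h, ?_⟩
    rw [size_eq (a := 0) (fun i hi => ((h i).1 hi).1), cnt_zero]
  · rintro k ⟨c, n, hc, h, rfl⟩
    obtain ⟨b', hb', hnb'⟩ := hX' n
    obtain ⟨b, ⟨hb, hnb⟩, hmin⟩ := dec_least (P := fun b => b ∈ (X : Set M.Num) ∧ n ≤ b)
      ⟨b', hb', hnb'.le⟩
    obtain ⟨d, hd, h'⟩ := exists_isFinCode X.2 (b + 1)
    refine ⟨d, b + 1, hd, h', ?_⟩
    rw [size_eq (c := d) (fun i hi => ((h' i).1 hi).1),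
      cnt_succ_of_mem ((h' b).2 ⟨num_lt_succ_self b, hb⟩),
      size_eq (c := c) (a := b) (fun i hi => ((h i).1 hi).1.trans_le hnb)]
    congr 1
    refine cnt_congr fun i hi => ?_
    rw [h, h']
    refine ⟨fun h => ⟨?_, h.2⟩, fun h => ⟨hi.trans (num_lt_succ_self b), h.2⟩⟩
    by_contra! hni
    exact hmin i hi ⟨h.2, hni⟩

/-- An injective function of `M`. -/
structure RecInj (M : L2Structure.{u}) [M.IsRCA0] where
  toFun : M.Num → M.Num
  fn : Fn (fun x : Fin 1 → M.Num => toFun (x 0))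
  inj : Function.Injective toFun

namespace RecInj

instance fn_app (h : RecInj M) {k : ℕ} {f : (Fin k → M.Num) → M.Num} [hf : Fn f] :
    Fn (fun x => h.toFun (f x)) :=
  .comp₁ h.fn hf

variable (h : RecInj M)

/-! ### Minimal values on intervals -/

/-- `v` is the least value of `h` on the interval `[e, f)`. -/
def IsLo (e f v : M.Num) : Prop :=
  (∃ m, e ≤ m ∧ m < f ∧ h.toFun m = v) ∧ ∀ m, e ≤ m → m < f → v ≤ h.toFun m

/-- The least value of `h` on the interval `[e, f)`. -/
noncomputable def lo (e f : M.Num) : M.Num := Classical.epsilon (h.IsLo e f)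

variable {h} {e f g m : M.Num}

theorem isLo_lo (hef : e < f) : h.IsLo e f (h.lo e f) := by
  obtain ⟨v, ⟨m, hm, hem, hv⟩, hmin⟩ := dec_least
    (P := fun v => ∃ m, m < f ∧ (e ≤ m ∧ h.toFun m = v)) ⟨h.toFun e, e, hef, le_rfl, rfl⟩
  refine Classical.epsilon_spec (p := h.IsLo e f) ⟨v, ⟨m, hem, hm, hv⟩, fun n hen hn => ?_⟩
  by_contra! hlt
  exact hmin _ hlt ⟨n, hn, hen, rfl⟩

theorem exists_eq_lo (hef : e < f) : ∃ m, e ≤ m ∧ m < f ∧ h.toFun m = h.lo e f := (isLo_lo hef).1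

theorem lo_le (hem : e ≤ m) (hmf : m < f) : h.lo e f ≤ h.toFun m :=
  (isLo_lo (hem.trans_lt hmf)).2 m hem hmf

theorem le_lo_iff {v : M.Num} (hef : e < f) :
    v ≤ h.lo e f ↔ ∀ m, e ≤ m → m < f → v ≤ h.toFun m := by
  refine ⟨fun hv m hem hmf => hv.trans (lo_le hem hmf), fun hv => ?_⟩
  obtain ⟨m, hem, hmf, hm⟩ := exists_eq_lo (h := h) hef
  exact hm ▸ hv m hem hmf

theorem lo_anti {e' f' : M.Num} (he : e ≤ e') (hef : e' < f') (hf : f' ≤ f) :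
    h.lo e f ≤ h.lo e' f' :=
  (le_lo_iff hef).2 fun _ hem hmf => lo_le (he.trans hem) (hmf.trans_le hf)

theorem lo_split (hef : e < f) (hfg : f < g) : h.lo e g = min (h.lo e f) (h.lo f g) := by
  refine le_antisymm (le_min (lo_anti le_rfl hef hfg.le) (lo_anti hef.le hfg le_rfl)) ?_
  refine (le_lo_iff (hef.trans hfg)).2 fun m hem hmg => ?_
  rcases lt_or_ge m f with hmf | hmf
  · exact (min_le_left _ _).trans (lo_le hem hmf)
  · exact (min_le_right _ _).trans (lo_le hmf hmg)

/-- The minima are attained at different arguments, so injectivity separates them. Hence a triple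
that is not ascending has strictly decreasing minima. -/
theorem lo_ne (hef : e < f) (hfg : f < g) : h.lo e f ≠ h.lo f g := by
  obtain ⟨m, -, hm, hm'⟩ := exists_eq_lo (h := h) hef
  obtain ⟨n, hn, -, hn'⟩ := exists_eq_lo (h := h) hfg
  rw [← hm', ← hn']
  exact fun heq => (hm.trans_le hn).ne (h.inj heq)

/-! ### A colouring of triples -/

variable (h) in
/-- The minimal values of `h` increase from `[e, f)` to `[f, g)`. -/
def Asc (e f g : M.Num) : Prop :=
  ∃ m, m < f ∧ (e ≤ m ∧ ∀ n, n < g → f ≤ n → h.toFun m < h.toFun n)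

theorem asc_iff (hef : e < f) (hfg : f < g) : h.Asc e f g ↔ h.lo e f < h.lo f g := by
  constructor
  · rintro ⟨m, hm, hem, hn⟩
    obtain ⟨n, hfn, hng, hn'⟩ := exists_eq_lo (h := h) hfg
    exact (lo_le hem hm).trans_lt (hn' ▸ hn n hng hfn)
  · intro hlt
    obtain ⟨m, hem, hm, hm'⟩ := exists_eq_lo (h := h) hef
    exact ⟨m, hm, hem, fun n hn hfn => hm' ▸ hlt.trans_le (lo_le hfn hn)⟩

theorem not_asc_iff (hef : e < f) (hfg : f < g) : ¬ h.Asc e f g ↔ h.lo f g < h.lo e f := by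
  rw [asc_iff hef hfg, not_lt]
  exact ⟨fun hle => hle.lt_of_ne (lo_ne hef hfg).symm, le_of_lt⟩

instance asc_dec {k : ℕ} {f g l : (Fin k → M.Num) → M.Num} [hf : Fn f] [hg : Fn g] [hl : Fn l] :
    Dec (fun x => h.Asc (f x) (g x) (l x)) :=
  .comp₃ (R := h.Asc) (by unfold Asc; infer_instance) hf hg hl

/-- A set that is homogeneous for the colouring stays so if it is extended at the lower end. -/
theorem homogeneous_extend {S : Set M.Num} {z x₀ x₁ x₂ : M.Num} {p : Prop}
    (h₁ : ∀ e ∈ S, ∀ f ∈ S, ∀ g ∈ S, e < f → f < g → g < z → (h.Asc e f g ↔ p))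
    (h₂ : ∀ e ∈ S, ∀ f ∈ S, ∀ g ∈ S, x₀ < e → e < f → f < g → g ≤ z → (h.Asc e f g ↔ p))
    (hx₀ : x₀ ∈ S) (hx₁ : x₁ ∈ S) (hx₂ : x₂ ∈ S) (hmin₀ : ∀ i ∈ S, x₀ ≤ i) (h01 : x₀ < x₁)
    (hmin₁ : ∀ i ∈ S, x₀ < i → x₁ ≤ i) (h12 : x₁ < x₂) (h2z : x₂ < z)
    (he : e ∈ S) (hf : f ∈ S) (hg : g ∈ S) (hef : e < f) (hfg : f < g) (hgz : g ≤ z) :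
    h.Asc e f g ↔ p := by
  rcases (hmin₀ e he).lt_or_eq with h0 | rfl
  · exact h₂ e he f hf g hg h0 hef hfg hgz
  rcases hgz.lt_or_eq with hgz | rfl
  · exact h₁ _ hx₀ f hf g hg hef hfg hgz
  -- Only the triples `x₀ < f < z` are left. They are compared with triples that omit `x₀` or `z`.
  have h012 := h₁ _ hx₀ _ hx₁ _ hx₂ h01 h12 h2z
  have h12z := h₂ _ hx₁ _ hx₂ _ hg h01 h12 h2z le_rfl
  by_cases hp : p
  · simp only [hp, iff_true] at h₁ h₂ h012 h12z ⊢
    rw [asc_iff hef hfg]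
    rw [asc_iff h01 h12] at h012
    rw [asc_iff h12 h2z] at h12z
    -- For `f = x₁`, the interval `[x₁, z)` is split at `x₂`. For larger `f`, the minimum on `[x₀,
    -- f)` is at most the one on `[x₁, f)`.
    rcases (hmin₁ f hf hef).eq_or_lt with rfl | hlt
    · rw [lo_split h12 h2z]
      exact lt_min h012 (h012.trans h12z)
    · have := h₂ _ hx₁ f hf g hg h01 hlt hfg le_rfl
      rw [asc_iff hlt hfg] at this
      exact (lo_anti h01.le hlt le_rfl).trans_lt this
  · simp only [hp, iff_false] at h₁ h₂ h012 h12z ⊢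
    rw [not_asc_iff hef hfg]
    rw [not_asc_iff h01 h12] at h012
    rcases (hmin₁ f hf hef).eq_or_lt with rfl | hlt
    · exact (lo_anti le_rfl h12 h2z.le).trans_lt h012
    · have h1 := h₂ _ hx₁ f hf g hg h01 hlt hfg le_rfl
      have h2 := h₁ _ hx₀ _ hx₁ f hf h01 hlt hfg
      rw [not_asc_iff hlt hfg] at h1
      rw [not_asc_iff h01 hlt] at h2
      -- The minimum on `[f, z)` is below the one on `[x₁, f)`, which is below the one on `[x₀,
      -- x₁)`.
      rw [lo_split h01 hlt]
      exact lt_min (h1.trans h2) h1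

variable (h) in
/-- The set `S ∩ [a, z]` is not homogeneous for the colouring of triples. -/
def Mixed (S : Set M.Num) (a z : M.Num) : Prop :=
  (∃ g, g ≤ z ∧ (g ∈ S ∧ ∃ f, f < g ∧ (f ∈ S ∧ ∃ e, e < f ∧ (e ∈ S ∧ a ≤ e ∧ h.Asc e f g)))) ∧
  (∃ g, g ≤ z ∧ (g ∈ S ∧ ∃ f, f < g ∧ (f ∈ S ∧ ∃ e, e < f ∧ (e ∈ S ∧ a ≤ e ∧ ¬ h.Asc e f g))))

instance mixed_dec (X : M.sets) {k : ℕ} {f g : (Fin k → M.Num) → M.Num} [hf : Fn f] [hg : Fn g] :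
    Dec (fun x => h.Mixed X (f x) (g x)) :=
  .comp₂ (R := h.Mixed X) (by unfold Mixed; infer_instance) hf hg

instance mixed_elts_dec {k : ℕ} {f g l : (Fin k → M.Num) → M.Num} [hf : Fn f] [hg : Fn g]
    [hl : Fn l] : Dec (fun x => h.Mixed (elts (f x)) (g x) (l x)) :=
  .comp₃ (R := fun s => h.Mixed (elts s)) (by unfold Mixed; infer_instance) hf hg hl

variable {S T : Set M.Num} {a b z y r : M.Num}

theorem Mixed.mono (hS : h.Mixed S a z) (hST : ∀ i ∈ S, a ≤ i → i ≤ z → i ∈ T ∧ b ≤ i)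
    (hzy : z ≤ y) : h.Mixed T b y := by
  refine hS.imp ?_ ?_ <;>
  · rintro ⟨g, hgz, hg, f, hfg, hf, e, hef, he, hae, hp⟩
    have hf' := hST f hf (hae.trans hef.le) (hfg.le.trans hgz)
    have hg' := hST g hg (hae.trans (hef.trans hfg).le) hgz
    have he' := hST e he hae ((hef.trans hfg).le.trans hgz)
    exact ⟨g, hgz.trans hzy, hg'.1, f, hfg, hf'.1, e, hef, he'.1, he'.2, hp⟩

/-- Two triples of different colours involve at least four elements. Even if both triples end in
`z`, they therefore have three distinct elements below `z` between them. -/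
theorem Mixed.exists_triple (hS : h.Mixed S a z) :
    ∃ e ∈ S, ∃ f ∈ S, ∃ g ∈ S, e < f ∧ f < g ∧ g < z := by
  obtain ⟨⟨g, hgz, hg, f, hfg, hf, e, hef, he, -, hp⟩,
    ⟨g', hgz', hg', f', hfg', hf', e', hef', he', -, hp'⟩⟩ := hS
  rcases hgz.lt_or_eq with hgz | rfl
  · exact ⟨e, he, f, hf, g, hg, hef, hfg, hgz⟩
  rcases hgz'.lt_or_eq with hgz' | rfl
  · exact ⟨e', he', f', hf', g', hg', hef', hfg', hgz'⟩
  rcases lt_trichotomy e e' with hlt | rfl | hlt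
  · exact ⟨e, he, e', he', f', hf', hlt, hef', hfg'⟩
  · rcases lt_trichotomy f f' with hlt | rfl | hlt
    · exact ⟨e, he, f, hf, f', hf', hef, hlt, hfg'⟩
    · exact absurd hp hp'
    · exact ⟨e, he, f', hf', f, hf, hef', hlt, hfg⟩
  · exact ⟨e', he', e, he, f, hf, hlt, hef, hfg⟩

variable (h) in
/-- `z` is minimal such that `S ∩ [0, z]` is not homogeneous. -/
def IsEnd (S : Set M.Num) (z : M.Num) : Prop :=
  h.Mixed S 0 z ∧ ∀ y, y < z → ¬ h.Mixed S 0 y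

instance isEnd_elts_dec {k : ℕ} {f g : (Fin k → M.Num) → M.Num} [hf : Fn f] [hg : Fn g] :
    Dec (fun x => h.IsEnd (elts (f x)) (g x)) :=
  .comp₂ (R := fun s => h.IsEnd (elts s)) (by unfold IsEnd; infer_instance) hf hg

theorem Mixed.congr (hS : h.Mixed S a z) (hST : ∀ i, i ≤ z → (i ∈ S ↔ i ∈ T)) : h.Mixed T a z :=
  hS.mono (fun i hi hai hiz => ⟨(hST i hiz).1 hi, hai⟩) le_rfl

theorem IsEnd.congr (hS : h.IsEnd S z) (hST : ∀ i, i ≤ z → (i ∈ S ↔ i ∈ T)) : h.IsEnd T z :=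
  ⟨hS.1.congr hST, fun y hy hT =>
    hS.2 y hy (hT.congr fun i hi => (hST i (hi.trans hy.le)).symm)⟩

theorem IsEnd.le (hS : h.IsEnd S z) (hT : h.Mixed T a y) (hTS : T ⊆ S) : z ≤ y := by
  by_contra! hlt
  exact hS.2 y hlt (hT.mono (fun i hi _ _ => ⟨hTS hi, zero_le⟩) le_rfl)

theorem IsEnd.unique (hS : h.IsEnd S z) (hS' : h.IsEnd S y) : z = y :=
  le_antisymm (hS.le hS'.1 subset_rfl) (hS'.le hS.1 subset_rfl)

/-- Otherwise both colours would occur already at the larger of the two top elements, which is below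
`z`. -/
theorem IsEnd.mem (hS : h.IsEnd S z) : z ∈ S := by
  obtain ⟨⟨g, hgz, hg, f, hfg, hf, e, hef, he, hae, hp⟩,
    ⟨g', hgz', hg', f', hfg', hf', e', hef', he', hae', hp'⟩⟩ := hS.1
  by_contra hz
  have h1 : g < z := hgz.lt_of_ne fun heq => hz (heq ▸ hg)
  have h2 : g' < z := hgz'.lt_of_ne fun heq => hz (heq ▸ hg')
  exact hS.2 (max g g') (max_lt h1 h2) ⟨⟨g, le_max_left _ _, hg, f, hfg, hf, e, hef, he, hae, hp⟩,
    ⟨g', le_max_right _ _, hg', f', hfg', hf', e', hef', he', hae', hp'⟩⟩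

variable (h) in
/-- The triples of elements of `S` below `z` include an ascending one. -/
def AscBelow (S : Set M.Num) (z : M.Num) : Prop :=
  ∃ g, g < z ∧ (g ∈ S ∧ ∃ f, f < g ∧ (f ∈ S ∧ ∃ e, e < f ∧ (e ∈ S ∧ h.Asc e f g)))

instance ascBelow_elts_dec {k : ℕ} {f g : (Fin k → M.Num) → M.Num} [hf : Fn f] [hg : Fn g] :
    Dec (fun x => h.AscBelow (elts (f x)) (g x)) :=
  .comp₂ (R := fun s => h.AscBelow (elts s)) (by unfold AscBelow; infer_instance) hf hg

theorem IsEnd.asc_iff (hS : h.IsEnd S z) (he : e ∈ S) (hf : f ∈ S) (hg : g ∈ S) (hef : e < f)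
    (hfg : f < g) (hgz : g < z) : h.Asc e f g ↔ h.AscBelow S z := by
  refine ⟨fun hp => ⟨g, hgz, hg, f, hfg, hf, e, hef, he, hp⟩, ?_⟩
  rintro ⟨g', hgz', hg', f', hfg', hf', e', hef', he', hp'⟩
  by_contra hp
  exact hS.2 (max g g') (max_lt hgz hgz')
    ⟨⟨g', le_max_right _ _, hg', f', hfg', hf', e', hef', he', zero_le, hp'⟩,
      ⟨g, le_max_left _ _, hg, f, hfg, hf, e, hef, he, zero_le, hp⟩⟩

variable (h) in
/-- `r` is the largest element of `S` such that `S ∩ [r, z]` is not homogeneous. -/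
def IsStart (S : Set M.Num) (z r : M.Num) : Prop :=
  r ∈ S ∧ h.Mixed S r z ∧ ∀ y, y ≤ z → y ∈ S → r < y → ¬ h.Mixed S y z

instance isStart_elts_dec {k : ℕ} {f g l : (Fin k → M.Num) → M.Num} [hf : Fn f] [hg : Fn g]
    [hl : Fn l] : Dec (fun x => h.IsStart (elts (f x)) (g x) (l x)) :=
  .comp₃ (R := fun s => h.IsStart (elts s)) (by unfold IsStart; infer_instance) hf hg hl

theorem Mixed.lt (hS : h.Mixed S a z) : a < z := by
  obtain ⟨⟨g, hgz, hg, f, hfg, hf, e, hef, he, hae, hp⟩, -⟩ := hS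
  exact hae.trans_lt (hef.trans (hfg.trans_le hgz))

theorem Mixed.exists_isStart {s : M.Num} (hS : h.Mixed (elts s) 0 z) :
    ∃ r, h.IsStart (elts s) z r := by
  obtain ⟨m, hm, hmin⟩ := dec_least (P := fun m => m ∈ elts s) (by
    obtain ⟨e, he, -⟩ := hS.exists_triple
    exact ⟨e, he⟩)
  have hmix : h.Mixed (elts s) m z :=
    hS.mono (fun i hi _ _ => ⟨hi, not_lt.1 fun hlt => hmin i hlt hi⟩) le_rfl
  obtain ⟨r, -, ⟨hr, hr'⟩, hmax⟩ := dec_greatest (n := z)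
    (P := fun r => r ∈ elts s ∧ h.Mixed (elts s) r z) ⟨m, hmix.lt, hm, hmix⟩
  exact ⟨r, hr, hr', fun y _ hy hry hmix => hry.not_ge (hmax y hmix.lt ⟨hy, hmix⟩)⟩

theorem IsStart.unique {r' : M.Num} (hr : h.IsStart S z r) (hr' : h.IsStart S z r') : r = r' := by
  rcases lt_trichotomy r r' with hlt | heq | hlt
  · exact absurd hr'.2.1 (hr.2.2 r' hr'.2.1.lt.le hr'.1 hlt)
  · exact heq
  · exact absurd hr.2.1 (hr'.2.2 r hr.2.1.lt.le hr.1 hlt)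

/-! ### Homogeneous sets -/

/-- Without ascending triples the minima on successive intervals between elements of `X` drop
strictly. After `c` steps there is a value at least `c` below the initial minimum, which is absurd
for large `c`. -/
theorem exists_asc {X : Set M.Num} (hX : X ∈ M.sets) (hX' : IsUnbounded X) :
    ∃ e ∈ X, ∃ f ∈ X, ∃ g ∈ X, e < f ∧ f < g ∧ h.Asc e f g := by
  by_contra! hno
  lift X to M.sets using hX
  obtain ⟨x, hx, -⟩ := hX' 0
  obtain ⟨y, hy, hxy⟩ := hX' x
  have key (c : M.Num) : ∃ e f, e ∈ (X : Set M.Num) ∧ f ∈ (X : Set M.Num) ∧ e < f ∧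
      ∃ m, m < f ∧ (e ≤ m ∧ h.toFun m + c ≤ h.lo x y) := by
    refine sig_ind (P := fun c => ∃ e f, e ∈ (X : Set M.Num) ∧ f ∈ (X : Set M.Num) ∧ e < f ∧
      ∃ m, m < f ∧ (e ≤ m ∧ h.toFun m + c ≤ h.lo x y)) (by infer_instance) ?_ ?_ c
    · obtain ⟨m, hem, hm, hm'⟩ := exists_eq_lo (h := h) hxy
      exact ⟨x, y, hx, hy, hxy, m, hm, hem, by rw [hm', add_zero]⟩
    · rintro c ⟨e, f, he, hf, hef, m, hm, hem, hle⟩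
      obtain ⟨g, hg, hfg⟩ := hX' f
      have := hno e he f hf g hg hef hfg
      rw [not_asc_iff hef hfg] at this
      obtain ⟨n, hfn, hn, hn'⟩ := exists_eq_lo (h := h) hfg
      refine ⟨f, g, hf, hg, hfg, n, hn, hfn, le_trans ?_ hle⟩
      rw [hn', add_comm c 1, ← add_assoc]
      exact add_le_add_left (num_succ_le_iff.2 (this.trans_le (lo_le hem hm))) c
  obtain ⟨e, f, -, -, -, m, -, -, hle⟩ := key (h.lo x y + 1)
  exact (num_lt_succ_self _).not_ge (le_add_self.trans hle)

/-- The minima on successive intervals between elements of `X` increase strictly, hence exceed any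
given number. This makes the complement of the range `Σ⁰₁`. -/
theorem range_mem_sets {X : Set M.Num} (hX : X ∈ M.sets) (hX' : IsUnbounded X)
    (hasc : ∀ e ∈ X, ∀ f ∈ X, ∀ g ∈ X, e < f → f < g → h.Asc e f g) :
    Set.range h.toFun ∈ M.sets := by
  lift X to M.sets using hX
  obtain ⟨x, hx, -⟩ := hX' 0
  obtain ⟨y, hy, hxy⟩ := hX' x
  have key (c : M.Num) : ∃ e f, e ∈ (X : Set M.Num) ∧ f ∈ (X : Set M.Num) ∧ e < f ∧
      ∀ m, m < f → e ≤ m → c ≤ h.toFun m := by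
    refine sig_ind (P := fun c => ∃ e f, e ∈ (X : Set M.Num) ∧ f ∈ (X : Set M.Num) ∧ e < f ∧
      ∀ m, m < f → e ≤ m → c ≤ h.toFun m) (by infer_instance) ?_ ?_ c
    · exact ⟨x, y, hx, hy, hxy, fun _ _ _ => zero_le⟩
    · rintro c ⟨e, f, he, hf, hef, hle⟩
      obtain ⟨g, hg, hfg⟩ := hX' f
      have := hasc e he f hf g hg hef hfg
      rw [asc_iff hef hfg] at this
      refine ⟨f, g, hf, hg, hfg, fun m hm hfm => num_succ_le_iff.2 ?_⟩
      exact ((le_lo_iff hef).2 fun m hem hm => hle m hm hem).trans_lt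
        (this.trans_le (lo_le hfm hm))
  -- An interval `[e, f)` on which all values exceed `n` certifies that `n` is not attained from `f`
  -- on, so only arguments below `f` have to be checked.
  have hneg (n : M.Num) : (¬ ∃ m, h.toFun m = n) ↔ ∃ e f, e ∈ (X : Set M.Num) ∧
      f ∈ (X : Set M.Num) ∧ e < f ∧ (∀ m, m < f → e ≤ m → n + 1 ≤ h.toFun m) ∧
        ∀ m, m < f → ¬ h.toFun m = n := by
    constructor
    · intro hn
      obtain ⟨e, f, he, hf, hef, hle⟩ := key (n + 1)
      exact ⟨e, f, he, hf, hef, hle, fun m _ hm => hn ⟨m, hm⟩⟩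
    · rintro ⟨e, f, he, hf, hef, hle, hlt⟩ ⟨m, rfl⟩
      rcases lt_or_ge m f with hmf | hmf
      · exact hlt m hmf rfl
      · obtain ⟨g, hg, hmg⟩ := hX' m
        have hfg := hmf.trans_lt hmg
        have h1 := hasc e he f hf g hg hef hfg
        rw [asc_iff hef hfg] at h1
        have h2 := (le_lo_iff hef).2 fun m hem hm => hle m hm hem
        exact (num_succ_le_iff.1 h2).not_ge (h1.le.trans (lo_le hmf hmg))
  refine hM.out.delta01_comprehension.exists_set (P := fun n => ∃ m, h.toFun m = n) ?_ ?_
  · infer_instance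
  · simp only [hneg]
    infer_instance

end RecInj

/-! ### Parity -/

/-- The number `n` of `M` is even. -/
def IsEven (n : M.Num) : Prop := ∃ r, r ≤ n ∧ n = r + r

instance IsEven.dec {k : ℕ} {f : (Fin k → M.Num) → M.Num} [hf : Fn f] :
    Dec (fun x => IsEven (f x)) :=
  .comp₁ (R := IsEven) (by unfold IsEven; infer_instance) hf

theorem isEven_succ_iff (n : M.Num) : IsEven (n + 1) ↔ ¬ IsEven n := by
  constructor
  · rintro ⟨r, -, hr⟩ ⟨q, -, rfl⟩
    rcases lt_or_ge q r with h | h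
    · have h1 : q + 1 ≤ r := num_succ_le_iff.2 h
      have h2 : (q + 1) + (q + 1) ≤ r + r := add_le_add h1 h1
      rw [← hr, ← add_assoc, add_right_comm q 1 q] at h2
      exact (num_lt_succ_self _).not_ge h2
    · exact ((num_lt_succ_self (q + q)).trans_eq hr).not_ge (add_le_add h h)
  · intro hn
    have key : IsEven n ∨ IsEven (n + 1) := by
      refine dec_ind (P := fun n : M.Num => IsEven n ∨ IsEven (n + 1))
        (.inl ⟨0, le_rfl, by rw [add_zero]⟩) (fun n ih => ?_) n
      rcases ih with ⟨r, hr, h⟩ | h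
      · refine .inr ⟨r + 1, add_le_add_left (hr.trans le_self_add) 1, ?_⟩
        conv_lhs => rw [h]
        ring
      · exact .inl h
    exact key.resolve_left hn

namespace RecInj

variable (h : RecInj M)

/-! ### The barrier and the array -/

/-- The set of all finite sets `s` with `z + 1` elements, where `z` is minimal such that
`s ∩ [0, z]` is not homogeneous. -/
def barrier : Set M.Num :=
  {s | IsFinCode s ∧ ∃ z, z ≤ s ∧ (h.IsEnd (elts s) z ∧ size s = z + 1)}

/-- A parity that is computed from the finite set with code `s`. -/
def Par (s : M.Num) : Prop :=
  ∃ z, z ≤ s ∧ (h.IsEnd (elts s) z ∧ ∃ r, r ≤ s ∧ (h.IsStart (elts s) z r ∧ IsEven (cnt s r)))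

/-- The colour below the end of the finite set with code `s`. -/
def Up (s : M.Num) : Prop :=
  ∃ z, z ≤ s ∧ (h.IsEnd (elts s) z ∧ h.AscBelow (elts s) z)

/-- The value of the array at `s` is `q`. -/
def Val (s q : M.Num) : Prop :=
  ((h.Par s ∧ h.Up s) ∧ q = 0) ∨ (¬ h.Par s ∧ q = 1) ∨ ((h.Par s ∧ ¬ h.Up s) ∧ q = 1 + 1)

/-- The array, as a set of pairs. -/
def array : Set M.Num :=
  {p | ∃ s, s ≤ p ∧ ∃ q, q ≤ p ∧ (p = pair s q ∧ s ∈ h.barrier ∧ h.Val s q)}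

variable {h}

instance barrier_dec {k : ℕ} {f : (Fin k → M.Num) → M.Num} [hf : Fn f] :
    Dec (fun x => f x ∈ h.barrier) :=
  .comp₁ (R := fun s => IsFinCode s ∧ ∃ z, z ≤ s ∧ (h.IsEnd (elts s) z ∧ size s = z + 1))
    (by infer_instance) hf

instance par_dec {k : ℕ} {f : (Fin k → M.Num) → M.Num} [hf : Fn f] :
    Dec (fun x => h.Par (f x)) :=
  .comp₁ (R := h.Par) (by unfold Par; infer_instance) hf

instance up_dec {k : ℕ} {f : (Fin k → M.Num) → M.Num} [hf : Fn f] :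
    Dec (fun x => h.Up (f x)) :=
  .comp₁ (R := h.Up) (by unfold Up; infer_instance) hf

instance val_dec {k : ℕ} {f g : (Fin k → M.Num) → M.Num} [hf : Fn f] [hg : Fn g] :
    Dec (fun x => h.Val (f x) (g x)) :=
  .comp₂ (R := h.Val) (by unfold Val; infer_instance) hf hg

theorem barrier_mem_sets : h.barrier ∈ M.sets :=
  Dec.exists_set (P := fun s => s ∈ h.barrier) inferInstance

theorem array_mem_sets : h.array ∈ M.sets :=
  Dec.exists_set (P := fun p => ∃ s, s ≤ p ∧ ∃ q, q ≤ p ∧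
    (p = pair s q ∧ s ∈ h.barrier ∧ h.Val s q)) (by infer_instance)

theorem pair_mem_array {s q : M.Num} : pair s q ∈ h.array ↔ s ∈ h.barrier ∧ h.Val s q := by
  constructor
  · rintro ⟨s', -, q', -, heq, hs, hv⟩
    obtain ⟨rfl, rfl⟩ := pair_injective heq
    exact ⟨hs, hv⟩
  · rintro ⟨hs, hv⟩
    exact ⟨s, left_le_pair _ _, q, right_le_pair _ _, rfl, hs, hv⟩

theorem isFunction_array : IsFunction h.array h.barrier M.three where
  mem_sets := array_mem_sets
  subset_prod := by
    rintro _ ⟨s, -, q, -, rfl, hs, hv⟩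
    refine ⟨s, hs, q, ?_, rfl⟩
    rcases hv with ⟨-, hq⟩ | ⟨-, hq⟩ | ⟨-, hq⟩
    · exact .inl hq
    · exact .inr (.inl hq)
    · exact .inr (.inr hq)
  existsUnique s hs := by
    simp only [pair_mem_array, hs, true_and]
    by_cases hp : h.Par s
    · by_cases hu : h.Up s
      · exact ⟨0, ⟨.inl rfl, by simp [Val, hp, hu]⟩, fun q hq => by simpa [Val, hp, hu] using hq.2⟩
      · exact ⟨1 + 1, ⟨.inr (.inr rfl), by simp [Val, hp, hu]⟩,
          fun q hq => by simpa [Val, hp, hu] using hq.2⟩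
    · exact ⟨1, ⟨.inr (.inl rfl), by simp [Val, hp]⟩, fun q hq => by simpa [Val, hp] using hq.2⟩

theorem exists_barrier_initSeg (hh : Set.range h.toFun ∉ M.sets) {X : Set M.Num}
    (hX : X ∈ M.sets) (hX' : IsUnbounded X) : ∃ s ∈ h.barrier, IsInitSeg (elts s) X := by
  obtain ⟨e, he, f, hf, g, hg, hef, hfg, hp⟩ := exists_asc (h := h) hX hX'
  obtain ⟨e', he', f', hf', g', hg', hef', hfg', hp'⟩ : ∃ e ∈ X, ∃ f ∈ X, ∃ g ∈ X,
      e < f ∧ f < g ∧ ¬ h.Asc e f g := by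
    by_contra! hno
    exact hh (range_mem_sets hX hX' hno)
  have hmix : ∃ z, h.Mixed X 0 z := ⟨max g g',
    ⟨g, le_max_left _ _, hg, f, hfg, hf, e, hef, he, zero_le, hp⟩,
    ⟨g', le_max_right _ _, hg', f', hfg', hf', e', hef', he', zero_le, hp'⟩⟩
  obtain ⟨z, hz, hmin⟩ : ∃ z, h.Mixed X 0 z ∧ ∀ y, y < z → ¬ h.Mixed X 0 y := by
    lift X to M.sets using hX
    exact dec_least (P := fun z => h.Mixed X 0 z) hmix
  have hend : h.IsEnd X z := ⟨hz, hmin⟩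
  obtain ⟨s, n, hs, hsn, hsize⟩ := exists_initSeg_size hX hX' (z + 1)
  -- At most `z` numbers lie below `z`, so an initial segment with `z + 1` elements cannot stop
  -- before `z`; it thus contains all of `X ∩ [0, z]`.
  have hzn : z < n := by
    by_contra! hnz
    have := cnt_le s z
    rw [← size_eq (fun i hi => ((hsn i).1 hi).1.trans_le hnz), hsize] at this
    exact (num_lt_succ_self z).not_ge this
  have hends : h.IsEnd (elts s) z := hend.congr fun i hi =>
    ⟨fun hiX => (hsn i).2 ⟨hi.trans_lt hzn, hiX⟩, fun his => ((hsn i).1 his).2⟩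
  refine ⟨s, ⟨hs, z, (lt_of_mem_elts hends.mem).le, hends, hsize⟩, fun i hi => ((hsn i).1 hi).2,
    fun i hi j hj hji => (hsn j).2 ⟨hji.trans ((hsn i).1 hi).1, hj⟩⟩

theorem isBarrier_barrier (hh : Set.range h.toFun ∉ M.sets) : IsBarrier h.barrier where
  mem_sets := barrier_mem_sets
  isFinCode _ hs := hs.1
  base_infinite a := by
    obtain ⟨s, hs, hsX⟩ := exists_barrier_initSeg hh (X := {i | a < i})
      (Dec.exists_set (P := fun i => a < i) inferInstance)
      (fun b => ⟨a + b + 1, num_lt_succ_iff_le.2 le_self_add, num_lt_succ_iff_le.2 le_add_self⟩)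
    obtain ⟨z, -, hz, -⟩ := hs.2
    exact ⟨z, ⟨s, hs, hz.mem⟩, hsX.1 hz.mem⟩
  exists_initSeg X hX hX' _ := exists_barrier_initSeg hh hX hX'
  not_ssubset s hs t ht hst := by
    obtain ⟨z, -, hz, hsz⟩ := hs.2
    obtain ⟨y, -, hy, hty⟩ := ht.2
    -- The larger set has the larger size, but its end comes no later, as it contains all triples of
    -- the smaller set.
    have h1 := size_lt_size hst
    rw [hsz, hty] at h1
    exact h1.not_ge (add_le_add_left (hy.le hz.1 hst.1) 1)

/-! ### The array is bad -/

theorem par_iff {s z r : M.Num} (hz : h.IsEnd (elts s) z) (hr : h.IsStart (elts s) z r) :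
    h.Par s ↔ IsEven (cnt s r) := by
  constructor
  · rintro ⟨y, -, hy, q, -, hq, he⟩
    obtain rfl := hz.unique hy
    obtain rfl := hr.unique hq
    exact he
  · exact fun he => ⟨z, (lt_of_mem_elts hz.mem).le, hz, r, (lt_of_mem_elts hr.1).le, hr, he⟩

theorem up_iff {s z : M.Num} (hz : h.IsEnd (elts s) z) : h.Up s ↔ h.AscBelow (elts s) z := by
  constructor
  · rintro ⟨y, -, hy, hu⟩
    obtain rfl := hz.unique hy
    exact hu
  · exact fun hu => ⟨z, (lt_of_mem_elts hz.mem).le, hz, hu⟩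

theorem cnt_eq_zero {c a : M.Num} (hc : ∀ i ∈ elts c, a ≤ i) : cnt c a = 0 := by
  refine dec_ind (P := fun b => b ≤ a → cnt c b = 0) (fun _ => cnt_zero c) (fun b ih hb => ?_) a
    (by infer_instance) le_rfl
  have hb := num_succ_le_iff.1 hb
  rw [cnt_succ_of_notMem (fun hm => hb.not_ge (hc b hm)), ih hb.le]

/-- Either alternative excludes equal values of the array: the value `1` records an odd parity,
while `0` and `2` record the colour in the even case. The case distinction is whether the mixture in
`s ∩ [0, z]` survives the removal of the least element. -/
theorem par_up_of_shift {s t : M.Num} (hs : s ∈ h.barrier) (ht : t ∈ h.barrier)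
    (hst : Shift s t) : (h.Par s ↔ ¬ h.Par t) ∨ (h.Par s ∧ (h.Up s ↔ ¬ h.Up t)) := by
  obtain ⟨z, -, hz, -⟩ := hs.2
  obtain ⟨y, -, hy, -⟩ := ht.2
  obtain ⟨u, -, hsu, htu⟩ := hst
  have su (i : M.Num) (hi : i ≤ z) : i ∈ elts s ↔ i ∈ elts u :=
    ⟨fun hm => hsu.1 hm, fun hm => hi.eq_or_lt.elim (fun heq => heq ▸ hz.mem)
      (fun hlt => hsu.2 z hz.mem i hm hlt)⟩
  have tu (i : M.Num) (hi : i ≤ y) : i ∈ elts t ↔ i ∈ tail (elts u) :=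
    ⟨fun hm => htu.1 hm, fun hm => hi.eq_or_lt.elim (fun heq => heq ▸ hy.mem)
      (fun hlt => htu.2 y hy.mem i hm hlt)⟩
  have hzu := hz.congr su
  have hyu := hy.congr tu
  obtain ⟨x₀, hx₀, hmin⟩ := dec_least (P := fun i => i ∈ elts u) ⟨z, hzu.mem⟩
  replace hmin (i : M.Num) (hi : i ∈ elts u) : x₀ ≤ i := not_lt.1 fun hlt => hmin i hlt hi
  have htail (i : M.Num) : i ∈ tail (elts u) ↔ i ∈ elts u ∧ x₀ < i :=
    ⟨fun hi => ⟨hi.1, hi.2.elim fun j hj => (hmin j hj.1).trans_lt hj.2⟩,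
      fun hi => ⟨hi.1, x₀, hx₀, hi.2⟩⟩
  have hzy : z ≤ y := hzu.le hyu.1 fun i hi => hi.1
  have hx₀s : x₀ ∈ elts s := (su x₀ (hmin z hzu.mem)).2 hx₀
  have ts (i : M.Num) (hi : i ≤ z) : i ∈ elts t ↔ i ∈ elts s ∧ x₀ < i := by
    rw [tu i (hi.trans hzy), htail, su i hi]
  obtain ⟨r, hr⟩ := hz.1.exists_isStart
  by_cases hmix : h.Mixed (elts t) 0 z
  · left
    -- The ends coincide, and so do the starts `q` and `r`, as both lie above `x₀`. The counts below
    -- the start then differ by exactly the element `x₀`.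
    obtain rfl : z = y := le_antisymm hzy (hy.le hmix subset_rfl)
    obtain ⟨q, hq⟩ := hy.1.exists_isStart
    have hqs := (ts q hq.2.1.lt.le).1 hq.1
    have hqr : q ≤ r := by
      by_contra! hlt
      exact hr.2.2 q hq.2.1.lt.le hqs.1 hlt
        (hq.2.1.mono (fun i hi hqi hiz => ⟨((ts i hiz).1 hi).1, hqi⟩) le_rfl)
    have hrx : x₀ < r := hqs.2.trans_le hqr
    obtain rfl : q = r := by
      by_contra hne
      exact hq.2.2 r hr.2.1.lt.le ((ts r hr.2.1.lt.le).2 ⟨hr.1, hrx⟩) (hqr.lt_of_ne hne)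
        (hr.2.1.mono (fun i hi hri hiz => ⟨(ts i hiz).2 ⟨hi, hrx.trans_le hri⟩, hri⟩) le_rfl)
    rw [par_iff hz hr, par_iff hy hq, ← isEven_succ_iff, cnt_eq_add_one (c := t) (d := s)
      (x := x₀) (fun hm => ((ts x₀ (hmin z hzu.mem)).1 hm).2.false) hx₀s hrx]
    intro i hi hne
    rw [ts i (hi.le.trans hr.2.1.lt.le)]
    exact ⟨And.left, fun hm => ⟨hm, (hmin i (hsu.1 hm)).lt_of_ne hne.symm⟩⟩
  · right
    -- A start above `x₀` would leave a mixed part inside `t`. So no element of `s` precedes `r`,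
    -- and the count is `0`.
    have hrx : r = x₀ := by
      refine ((hmin r (hsu.1 hr.1)).eq_or_lt.resolve_right fun hlt => hmix ?_).symm
      exact hr.2.1.mono (fun i hi hri hiz => ⟨(ts i hiz).2 ⟨hi, hlt.trans_le hri⟩, zero_le⟩) le_rfl
    refine ⟨?_, ?_⟩
    · rw [par_iff hz hr, cnt_eq_zero fun i hi => hrx ▸ hmin i (hsu.1 hi)]
      exact ⟨0, le_rfl, by rw [add_zero]⟩
    · rw [up_iff hz, up_iff hy]
      by_contra hne
      have hiff : h.AscBelow (elts s) z ↔ h.AscBelow (elts t) y := by tauto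
      have hlt : z < y := hzy.lt_of_ne (by rintro rfl; exact hmix hy.1)
      obtain ⟨e, he, f, hf, g, hg, hef, hfg, hgz⟩ := hz.1.exists_triple
      have hf0 : x₀ < f := (hmin e (hsu.1 he)).trans_lt hef
      obtain ⟨x₁, ⟨hx₁, h01⟩, hmin₁⟩ := dec_least (P := fun i => i ∈ elts s ∧ x₀ < i)
        ⟨f, hf, hf0⟩
      replace hmin₁ (i : M.Num) (hi : i ∈ elts s) (h0 : x₀ < i) : x₁ ≤ i :=
        not_lt.1 fun hlt => hmin₁ i hlt ⟨hi, h0⟩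
      have h1g : x₁ < g := (hmin₁ f hf hf0).trans_lt hfg
      -- Below `z` the colour of `s` is constant, and so is that of `t` below `y`, where now `z <
      -- y`. If the two colours agree, all triples of `s` up to and including `z` have this colour,
      -- against the choice of `z`.
      have hall : ∀ e ∈ elts s, ∀ f ∈ elts s, ∀ g ∈ elts s, e < f → f < g → g ≤ z →
          (h.Asc e f g ↔ h.AscBelow (elts s) z) :=
        fun e he' f hf' g hg' hef' hfg' hgz' => homogeneous_extend
          (fun e he f hf g hg hef hfg hgz => hz.asc_iff he hf hg hef hfg hgz)
          (fun e he f hf g hg h0 hef hfg hgz => by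
            rw [hiff]
            exact hy.asc_iff ((ts e ((hef.trans hfg).le.trans hgz)).2 ⟨he, h0⟩)
              ((ts f (hfg.le.trans hgz)).2 ⟨hf, h0.trans hef⟩)
              ((ts g hgz).2 ⟨hg, h0.trans (hef.trans hfg)⟩) hef hfg (hgz.trans_lt hlt))
          hx₀s hx₁ hg (fun i hi => hmin i (hsu.1 hi)) h01 hmin₁
          h1g hgz he' hf' hg' hef' hfg' hgz'
      obtain ⟨⟨g, hgz, hg, f, hfg, hf, e, hef, he, -, hp⟩,
        ⟨g', hgz', hg', f', hfg', hf', e', hef', he', -, hp'⟩⟩ := hz.1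
      rw [hall e he f hf g hg hef hfg hgz] at hp
      rw [hall e' he' f' hf' g' hg' hef' hfg' hgz'] at hp'
      exact hp' hp

theorem not_val_eq_of_shift {s t q : M.Num} (hs : s ∈ h.barrier) (ht : t ∈ h.barrier)
    (hst : Shift s t) (hsq : h.Val s q) (htq : h.Val t q) : False := by
  have h01 : (0 : M.Num) ≠ 1 := num_zero_lt_one.ne
  have h12 : (1 : M.Num) ≠ 1 + 1 := (num_lt_succ_self 1).ne
  have h02 : (0 : M.Num) ≠ 1 + 1 := (num_zero_lt_one.trans (num_lt_succ_self 1)).ne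
  have := par_up_of_shift hs ht hst
  unfold Val at hsq htq
  grind

theorem range_mem_sets_of_threeIsBQO (h : RecInj M) (h3 : M.ThreeIsBQO) :
    Set.range h.toFun ∈ M.sets := by
  by_contra hh
  obtain ⟨s, hs, t, ht, hst, p, q, hp, hq, rfl⟩ :=
    h3.good h.barrier (isBarrier_barrier hh) h.array isFunction_array
  exact not_val_eq_of_shift hs ht hst (pair_mem_array.1 hp).2 (pair_mem_array.1 hq).2

end RecInj

/-! ### An injection that enumerates a `Σ⁰₁` set -/

/-- `x` is the pair of the least witness and the element `n` of the set enumerated by `R`. -/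
def Enum (R : M.sets) (x n : M.Num) : Prop :=
  ∃ a, a ≤ x ∧ (x = pair a n ∧ pair a n ∈ (R : Set M.Num) ∧
    ∀ b, b < a → ¬ pair b n ∈ (R : Set M.Num))

instance Enum.dec (R : M.sets) {k : ℕ} {f g : (Fin k → M.Num) → M.Num} [hf : Fn f] [hg : Fn g] :
    Dec (fun x => Enum R (f x) (g x)) :=
  .comp₂ (R := Enum R) (by unfold Enum; infer_instance) hf hg

theorem Enum.le {R : M.sets} {x n : M.Num} (h : Enum R x n) : n ≤ x := by
  obtain ⟨a, -, rfl, -⟩ := h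
  exact right_le_pair a n

theorem Enum.unique_right {R : M.sets} {x n n' : M.Num} (h : Enum R x n) (h' : Enum R x n') :
    n = n' := by
  obtain ⟨a, -, rfl, -⟩ := h
  obtain ⟨b, -, h, -⟩ := h'
  exact (pair_injective h).2

/-- Minimality of the witness lets each element be enumerated only once, which makes `enumFun`
injective. -/
theorem Enum.unique_left {R : M.sets} {x x' n : M.Num} (h : Enum R x n) (h' : Enum R x' n) :
    x = x' := by
  obtain ⟨a, -, rfl, ha, ha'⟩ := h
  obtain ⟨b, -, rfl, hb, hb'⟩ := h'
  rcases lt_trichotomy a b with hlt | rfl | hlt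
  · exact absurd ha (hb' a hlt)
  · rfl
  · exact absurd hb (ha' b hlt)

open Classical in
/-- The function that maps `x` to `2n` if `x` enumerates `n`, and to `2x + 1` otherwise. -/
noncomputable def enumFun (R : M.sets) (x : M.Num) : M.Num :=
  if hx : ∃ n, Enum R x n then hx.choose + hx.choose else x + x + 1

theorem enumFun_of_enum {R : M.sets} {x n : M.Num} (h : Enum R x n) : enumFun R x = n + n := by
  have hx : ∃ n, Enum R x n := ⟨n, h⟩
  rw [enumFun, dif_pos hx, hx.choose_spec.unique_right h]

theorem enumFun_of_not {R : M.sets} {x : M.Num} (h : ¬ ∃ n, Enum R x n) :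
    enumFun R x = x + x + 1 := dif_neg h

theorem add_self_injective {a b : M.Num} (h : a + a = b + b) : a = b := by
  rcases lt_trichotomy a b with hlt | rfl | hlt
  · exact absurd h (add_lt_add hlt hlt).ne
  · rfl
  · exact absurd h (add_lt_add hlt hlt).ne'

theorem add_self_ne (a b : M.Num) : a + a ≠ b + b + 1 := fun h =>
  (isEven_succ_iff (b + b)).1 ⟨a, h ▸ le_self_add, h.symm⟩ ⟨b, le_self_add, rfl⟩

/-- The function `enumFun R` as an injection of `M`. -/
noncomputable def enumInj (R : M.sets) : RecInj M where
  toFun := enumFun R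
  fn := by
    refine ⟨?_⟩
    have (y x : M.Num) : y = enumFun R x ↔ (∃ n, n ≤ x ∧ (Enum R x n ∧ y = n + n)) ∨
        ((∀ n, n ≤ x → ¬ Enum R x n) ∧ y = x + x + 1) := by
      by_cases hx : ∃ n, Enum R x n
      · obtain ⟨n, hn⟩ := hx
        rw [enumFun_of_enum hn]
        refine ⟨fun h => .inl ⟨n, hn.le, hn, h⟩, ?_⟩
        rintro (⟨m, -, hm, rfl⟩ | ⟨h, -⟩)
        · rw [hn.unique_right hm]
        · exact absurd hn (h n hn.le)
      · rw [enumFun_of_not hx]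
        refine ⟨fun h => .inr ⟨fun n _ hn => hx ⟨n, hn⟩, h⟩, ?_⟩
        rintro (⟨m, -, hm, rfl⟩ | ⟨-, h⟩)
        · exact absurd ⟨m, hm⟩ hx
        · exact h
    simp only [this]
    infer_instance
  inj x y hxy := by
    by_cases hx : ∃ n, Enum R x n
    · obtain ⟨n, hn⟩ := hx
      rw [enumFun_of_enum hn] at hxy
      by_cases hy : ∃ n, Enum R y n
      · obtain ⟨m, hm⟩ := hy
        rw [enumFun_of_enum hm] at hxy
        obtain rfl := add_self_injective hxy
        exact hn.unique_left hm
      · rw [enumFun_of_not hy] at hxy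
        exact absurd hxy (add_self_ne n y)
    · rw [enumFun_of_not hx] at hxy
      by_cases hy : ∃ n, Enum R y n
      · obtain ⟨m, hm⟩ := hy
        rw [enumFun_of_enum hm] at hxy
        exact absurd hxy.symm (add_self_ne m x)
      · rw [enumFun_of_not hy] at hxy
        exact add_self_injective (add_right_cancel hxy)

theorem mem_range_enumInj {R : M.sets} {n : M.Num} :
    n + n ∈ Set.range (enumInj R).toFun ↔ ∃ a, pair a n ∈ (R : Set M.Num) := by
  constructor
  · rintro ⟨x, hx⟩
    change enumFun R x = n + n at hx
    by_cases hx' : ∃ m, Enum R x m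
    · obtain ⟨m, hm⟩ := hx'
      rw [enumFun_of_enum hm] at hx
      obtain rfl := add_self_injective hx
      obtain ⟨a, -, -, ha, -⟩ := hm
      exact ⟨a, ha⟩
    · rw [enumFun_of_not hx'] at hx
      exact absurd hx.symm (add_self_ne n x)
  · intro hex
    obtain ⟨a, ha, hmin⟩ := dec_least (P := fun a => pair a n ∈ (R : Set M.Num)) hex
    exact ⟨pair a n, enumFun_of_enum ⟨a, left_le_pair a n, rfl, ha, hmin⟩⟩

/-! ### Comprehension -/

/-- The matrix of the `Σ⁰₁` definition becomes a set `R` of pairs. The elements `n` of the desired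
set are those for which `n + n` is a value of `enumInj R`, the odd values being mere fillers. -/
theorem sig_mem_sets_of_threeIsBQO (h3 : M.ThreeIsBQO) (P : M.Num → Prop)
    (hP : Sig (fun x : Fin 1 → M.Num => P (x 0))) : {a | P a} ∈ M.sets := by
  obtain ⟨Q, hQ, hPQ⟩ := hP.exists_bd
  have hQ' : Dec (fun x : Fin 2 → M.Num => Q (x 0) (fun _ => x 1)) := by
    convert Dec.of_bd hQ using 3 with x
    funext i
    rw [Subsingleton.elim i 0]
    rfl
  have hR : {p | Contract (fun x : Fin 2 → M.Num => Q (x 0) (fun _ => x 1)) (fun _ => p)} ∈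
      M.sets := Dec.exists_set (P := fun p => Contract _ (fun _ => p)) (by
        rw [eq_const_apply]
        exact hQ'.contract)
  have hmem (a n : M.Num) : pair a n ∈
      {p | Contract (fun x : Fin 2 → M.Num => Q (x 0) (fun _ => x 1)) (fun _ => p)} ↔
        Q a (fun _ => n) := by
    constructor
    · rintro ⟨b, m, heq, hq⟩
      obtain ⟨rfl, rfl⟩ := pair_injective heq
      exact hq
    · exact fun hq => ⟨a, n, rfl, hq⟩
  have hX := (enumInj ⟨_, hR⟩).range_mem_sets_of_threeIsBQO h3
  convert Dec.exists_set (P := fun n => n + n ∈ ((⟨_, hX⟩ : M.sets) : Set M.Num)) inferInstance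
    using 2
  ext n
  exact (hPQ fun _ => n).trans
    ((exists_congr fun a => (hmem a n).symm).trans (mem_range_enumInj (R := ⟨_, hR⟩)).symm)

instance Tm.termVal {k : ℕ} (t : Term k) : Tm (fun x : Fin k → M.Num => M.termVal x t) :=
  ⟨k, t, .inl, fun _ => rfl⟩

/-- Induction on `φ`: a number quantifier in front of a bounded formula gives a `Σ⁰₁` relation or
the negation of one. By `H` this is bounded again, relative to a new set parameter. -/
theorem bd_realize_of_forall
    (H : ∀ P : M.Num → Prop, Sig (fun x : Fin 1 → M.Num => P (x 0)) → {a | P a} ∈ M.sets)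
    {k m : ℕ} (φ : Formula k m) (hφ : φ.IsArithmetical) (v : Fin m → M.sets) :
    Bd (fun x : Fin k → M.Num => M.Realize φ x v) := by
  induction φ with
  | eq s t => exact Bd.eq
  | lt s t => exact Bd.lt
  | mem t X => exact Bd.mem (v X)
  | neg φ ih =>
    have := ih hφ v
    exact Bd.not
  | and φ ψ ih ih' =>
    have := ih hφ.1 v
    have := ih' hφ.2 v
    exact Bd.and
  | or φ ψ ih ih' =>
    have := ih hφ.1 v
    have := ih' hφ.2 v
    exact Bd.or
  | imp φ ψ ih ih' =>
    have := ih hφ.1 v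
    have := ih' hφ.2 v
    exact Bd.imp
  | allNum φ ih =>
    have := ih hφ v
    have h := Sig.bd_of_forall H (Sig.of_bd (P := fun a x => ¬ M.Realize φ (Fin.cons a x) v) (by
      convert (inferInstance : Bd (fun x => ¬ M.Realize φ x v)) using 4 with x
      exact Fin.cons_self_tail x))
    convert Bd.not (hP := h) using 2 with x
    simp only [Realize, not_exists, not_not]
  | exNum φ ih =>
    refine Sig.bd_of_forall H (Sig.of_bd (P := fun a x => M.Realize φ (Fin.cons a x) v) ?_)
    convert ih hφ v using 3 with x
    exact Fin.cons_self_tail x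
  | allSet φ => exact hφ.elim
  | exSet φ => exact hφ.elim

theorem arithmeticalComprehension_of_forall
    (H : ∀ P : M.Num → Prop, Sig (fun x : Fin 1 → M.Num => P (x 0)) → {a | P a} ∈ M.sets) :
    M.ArithmeticalComprehension := by
  intro k m φ hφ e v
  have h1 := (bd_realize_of_forall H φ hφ v).out.subst
    (Fin.cons (.inl 0) (fun i => .inr (e i)) : Fin (k + 1) → Fin 1 ⊕ M.Num)
  have h2 : Bd (fun x : Fin 1 → M.Num => M.Realize φ (Fin.cons (x 0) e) v) := by
    refine ⟨?_⟩
    convert h1 using 3 with x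
    funext i
    refine Fin.cases ?_ (fun j => ?_) i <;> simp [look]
  exact ⟨_, Dec.exists_set (P := fun a => M.Realize φ (Fin.cons a e) v) (.of_bd h2),
    fun a => Iff.rfl⟩

end L2Structure

theorem mainTheorem6 (M : L2Structure.{u}) (hM : M.IsModelRCA0) (h3 : M.ThreeIsBQO) :
    M.ArithmeticalComprehension := by
  have : M.IsRCA0 := ⟨hM⟩
  exact L2Structure.arithmeticalComprehension_of_forall
    (L2Structure.sig_mem_sets_of_threeIsBQO h3)
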